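/- Let $L\ge 1$ be a fixed integer. For $N\ge 1$ let $$\psi_N(z)=\sum_{m=0}^{N}\sqrt{\binom{m+L-1}{m}}\;a_m z^m ,$$ where $a_0,\dots,a_N$ are independent standard complex Gaussian random variables (the real and imaginary parts of each $a_m$ are independent, centred, of variance $1/2$, so $E|a_m|^2=1$). The density of zeros $p_N$ of $\psi_N$ is the continuous function $p_N:\mathbb C\to\mathbb R$ such that $$E\Big(\sum_j \phi(z_j)\Big)=\int_{\mathbb C}p_N(z)\,\phi(z)\,dx\,dy$$ for every real-valued $\phi\in C_c^\infty(\mathbb C)$, where the $z_j$ are the zeros of $\psi_N$ counted with multiplicity (and the expectation on the left is finite). Let $g(s)=\frac{e^s-1}{s}$ for $s\neq0$, $g(0)=1$, and let $g^{(j)}$ be its $j$-th derivative. Then: 1. For every $N\ge1$ the density $p_N$ exists and is unique. 2. For every $A>0$ there is a constant $C>0$, depending only on $A$ and $L$, such that for all $N\ge1$, all $s\in[-A,A]$ with $1+s/N\ge 0$ and all $\theta\in\mathbb R$, $$\left|N^{-2}\,p_N\!\left(\Big(1+\frac sN\Big)^{1/2}e^{i\theta}\right)-\frac1\pi\left[\frac{g^{(L)}}{g^{(L-1)}}\right]'(s)\right|\le\frac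 CN .$$ 3. The zeros concentrate in an annulus of width of order $1/N$ around the unit circle: for every $\varepsilon>0$ there is $A>0$, depending only on $\varepsilon$ and $L$, such that for all $N\ge1$ the expected number of zeros of $\psi_N$ (counted with multiplicity) in $\{z:\big||z|-1\big|\le A/N\}$ is at least $(1-\varepsilon)N$. -/

import Mathlib

open MeasureTheory ProbabilityTheory Polynomial

universe u

/-- The standard complex Gaussian law: independent real and imaginary parts of law `N(0, 1/2)`,
so that `E a = 0`, `E |a|^2 = 1`, `E a^2 = 0`. -/
noncomputable def stdComplexGaussian : Measure ℂ :=
  ((gaussianReal 0 (1 / 2)).prod (gaussianReal 0 (1 / 2))).map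
    Complex.measurableEquivRealProd.symm

/-- The random variables `a 0, …, a N` are independent standard complex Gaussians. -/
def IsIIDStdComplexGaussian {Ω : Type u} [MeasurableSpace Ω] (P : Measure Ω) {N : ℕ}
    (a : Fin (N + 1) → Ω → ℂ) : Prop :=
  iIndepFun a P ∧ ∀ m, HasLaw (a m) stdComplexGaussian P

/-- The polynomial `∑_{m ≤ N} √C(m + L - 1, m) c_m z^m` (used for `L ≥ 1`). -/
noncomputable def su11Poly (L : ℕ) {N : ℕ} (c : Fin (N + 1) → ℂ) : ℂ[X] :=
  ∑ m : Fin (N + 1),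
    C (((√((Nat.choose ((m : ℕ) + L - 1) (m : ℕ) : ℕ) : ℝ) : ℝ) : ℂ) * c m) * X ^ (m : ℕ)

/-- `p` is the (continuous) density of zeros of the random polynomial `ψ`: for every smooth
compactly supported test function `φ`, the linear statistic `∑_j φ(z_j)` over the zeros of `ψ`,
counted with multiplicity, has a finite expectation, equal to `∫ p φ dx dy`.
Continuity pins down the pointwise values of `p`. -/
def IsZeroDensity {Ω : Type u} [MeasurableSpace Ω] (P : Measure Ω) (ψ : Ω → ℂ[X])
    (p : ℂ → ℝ) : Prop :=
  Continuous p ∧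
  ∀ φ : ℂ → ℝ, ContDiff ℝ (⊤ : ℕ∞) φ → HasCompactSupport φ →
    Integrable (fun ω => ((ψ ω).roots.map φ).sum) P ∧
    ∫ ω, ((ψ ω).roots.map φ).sum ∂P = ∫ z : ℂ, p z * φ z

open Classical in
/-- The number of zeros of `q` in `S`, counted with multiplicity. -/
noncomputable def zeroCount (q : ℂ[X]) (S : Set ℂ) : ℕ :=
  (q.roots.filter (fun z => z ∈ S)).card

open Classical in
/-- The entire function `(e^s - 1) / s = ∑ s^j / (j + 1)!` on the real line, with value `1` at
`s = 0`. -/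
noncomputable def expQuot (s : ℝ) : ℝ :=
  if s = 0 then 1 else (Real.exp s - 1) / s

/-! The conjugate of `1 / (z - w)` is the gradient of `log |z - w|`, whose weak Laplacian is `2π
δ_w`. Hence `∑ φ(z_j)` equals `-(2π)⁻¹ ∫ dφ(conj (ψ'/ψ))` (`integral_fderiv_conj_sum_one_div`). A
bound on the Cauchy kernel that is uniform in the position of its pole, together with the bound `N`
on the number of roots, justifies Fubini, so only `E[ψ'(z)/ψ(z)]` is needed. This is the mean of a
ratio of two linear forms in a Gaussian vector. Unitary invariance removes the part of the numerator
orthogonal to the denominator (`integral_inner_div_inner`) and leaves `z⁻¹ M(|z|²)`, where `M = t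
K'/K` and `K(t) = ∑ C(m+L-1, m) t^m`. Integrating back by parts in polar coordinates gives the
density `π⁻¹ M'(|z|²)`; continuity makes it unique. Put `L = k + 1` and `t = 1 + s/N`. Then `N⁻²
M'(t)` is `1/t` times the variance of `m/N` under weights proportional to `C(m+k, m) t^m`. Since `k!
C(m+k, m) ≈ m^k` and `t^m ≈ e^{sm/N}`, its moments are Riemann sums for `∫₀¹ x^{k+j} e^{sx} dx`, the
derivatives of `g`, each with error `O(1/N)`. The limiting variance is the derivative of
`g^{(k+1)}/g^{(k)}`. The expected number of zeros in `a ≤ |z| ≤ b` is `M(b²) - M(a²)`. Elementary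
summation gives `M(t) ≤ L/(1-t)` inside the circle and `M(t) ≥ N - 1/(t-1)` outside, so a width of
order `1/N` captures all but a small fraction of the zeros. -/

/-! ### Complex Gaussian vectors and their unitary invariance. -/

instance isProbabilityMeasure_stdComplexGaussian : IsProbabilityMeasure stdComplexGaussian :=
  Measure.isProbabilityMeasure_map (Complex.measurableEquivRealProd.symm.measurable.aemeasurable)

instance nullSingletonClass_stdComplexGaussian : NullSingletonClass stdComplexGaussian := by
  have h0 : NullSingletonClass (gaussianReal 0 (1 / 2)) :=
    nullSingletonClass_gaussianReal (by norm_num)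
  refine ⟨fun x => ?_⟩
  rw [stdComplexGaussian, MeasurableEquiv.map_apply]
  refine measure_mono_null (t := {x.re} ×ˢ {x.im}) ?_ ?_
  · rintro a ha
    simp only [Set.mem_preimage, Set.mem_singleton_iff] at ha
    rw [← ha]
    simp [Complex.measurableEquivRealProd]
  · rw [Measure.prod_prod, measure_singleton, zero_mul]

theorem charFun_stdComplexGaussian (t : ℂ) :
    charFun stdComplexGaussian t = Complex.exp (-(‖t‖ : ℂ) ^ 2 / 4) := by
  have h : ∀ x : ℝ × ℝ, Complex.exp (((inner ℝ (Complex.measurableEquivRealProd.symm x) t : ℝ) : ℂ)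
      * Complex.I) = Complex.exp ((inner ℝ x.1 t.re : ℝ) * Complex.I) *
        Complex.exp ((inner ℝ x.2 t.im : ℝ) * Complex.I) := by
    intro x
    rw [← Complex.exp_add]
    congr 1
    simp [Complex.inner, Complex.measurableEquivRealProd]
    ring
  rw [charFun_apply, stdComplexGaussian, integral_map_equiv]
  simp_rw [h]
  rw [integral_prod_mul (fun x : ℝ => Complex.exp ((inner ℝ x t.re : ℝ) * Complex.I))
    (fun x : ℝ => Complex.exp ((inner ℝ x t.im : ℝ) * Complex.I)), ← charFun_apply, ← charFun_apply,
    charFun_gaussianReal, charFun_gaussianReal, ← Complex.exp_add]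
  congr 1
  have : (‖t‖ : ℂ) ^ 2 = (t.re : ℂ) ^ 2 + (t.im : ℂ) ^ 2 := by
    rw [← Complex.ofReal_pow, Complex.sq_norm, Complex.normSq_apply]
    push_cast; ring
  rw [this]
  push_cast
  ring

/-- The law of a vector of independent standard complex Gaussians. -/
noncomputable def complexGaussianVector (n : ℕ) : Measure (EuclideanSpace ℂ (Fin n)) :=
  (Measure.pi (fun _ : Fin n => stdComplexGaussian)).map (WithLp.toLp 2)

instance isProbabilityMeasure_complexGaussianVector (n : ℕ) :
    IsProbabilityMeasure (complexGaussianVector n) :=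
  Measure.isProbabilityMeasure_map (Measurable.aemeasurable (by fun_prop))

theorem charFun_complexGaussianVector {n : ℕ} (t : EuclideanSpace ℂ (Fin n)) :
    charFun (complexGaussianVector n) t = Complex.exp (-(‖t‖ : ℂ) ^ 2 / 4) := by
  rw [complexGaussianVector, charFun_pi]
  simp_rw [charFun_stdComplexGaussian, ← Complex.exp_sum]
  rw [← Complex.ofReal_pow, EuclideanSpace.norm_sq_eq]
  push_cast
  rw [← Finset.sum_div, Finset.sum_neg_distrib]

/-- The characteristic function depends on `t` only through its norm, and an isometry moves onto `t`
as its inverse. -/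
theorem map_complexGaussianVector {n : ℕ}
    (f : EuclideanSpace ℂ (Fin n) ≃ₗᵢ[ℂ] EuclideanSpace ℂ (Fin n)) :
    (complexGaussianVector n).map f = complexGaussianVector n := by
  have hf : Measurable f := f.continuous.measurable
  have := Measure.isProbabilityMeasure_map (μ := complexGaussianVector n) hf.aemeasurable
  refine Measure.ext_of_charFun ?_
  ext t
  have h : ∀ x, inner ℝ (f x) t = inner ℝ x (f.symm t) := by
    intro x
    have h1 := f.inner_map_map x (f.symm t)
    rw [f.apply_symm_apply] at h1
    have h2 : ∀ a b : EuclideanSpace ℂ (Fin n), inner ℝ a b = (inner ℂ a b).re := by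
      intro a b
      simp [PiLp.inner_apply, Complex.inner]
    rw [h2, h2, h1]
  rw [charFun_apply, integral_map hf.aemeasurable (by fun_prop)]
  simp_rw [h]
  rw [← charFun_apply, charFun_complexGaussianVector, charFun_complexGaussianVector,
    LinearIsometryEquiv.norm_map]

/-! ### Expectation of a ratio of Gaussian linear forms. -/

/-- The reflection in the line of `v` preserves the law, fixes the denominator and negates the
numerator, so the integral equals its own negative. The Bochner integral's conventions make
integrability unnecessary here. -/
theorem integral_inner_div_inner_of_orthogonal {n : ℕ} {v w : EuclideanSpace ℂ (Fin n)}
    (h : inner ℂ v w = 0) :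
    ∫ c, inner ℂ w c / inner ℂ v c ∂complexGaussianVector n = 0 := by
  set R := (ℂ ∙ v).reflection
  have hv : ∀ c, inner ℂ v (R c) = inner ℂ v c := fun c => by
    have h1 : R v = v :=
      Submodule.reflection_mem_subspace_eq_self (Submodule.mem_span_singleton_self v)
    conv_lhs => rw [← h1]
    exact R.inner_map_map v c
  have hw : ∀ c, inner ℂ w (R c) = -inner ℂ w c := fun c => by
    have h1 : R w = -w := Submodule.reflection_mem_subspace_orthogonalComplement_eq_neg
      (Submodule.mem_orthogonal_singleton_iff_inner_right.2 h)
    have h2 := R.inner_map_map w c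
    rw [h1, inner_neg_left] at h2
    rw [← h2, neg_neg]
  have h1 : ∫ c, inner ℂ w c / inner ℂ v c ∂complexGaussianVector n =
      ∫ c, inner ℂ w (R c) / inner ℂ v (R c) ∂complexGaussianVector n := by
    conv_lhs => rw [← map_complexGaussianVector R]
    exact integral_map R.continuous.measurable.aemeasurable
      (Measurable.aestronglyMeasurable (by fun_prop))
  simp_rw [hv, hw, neg_div] at h1
  rw [integral_neg] at h1
  exact self_eq_neg.1 h1

/-- Project `u` onto `v`: the parallel part contributes a constant ratio and the orthogonal part
integrates to zero. -/
theorem integral_inner_div_inner {n : ℕ} {u v : EuclideanSpace ℂ (Fin n)} (hv : v ≠ 0)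
    (hne : ∀ᵐ c ∂complexGaussianVector n, inner ℂ v c ≠ 0)
    (hint : Integrable (fun c => inner ℂ u c / inner ℂ v c) (complexGaussianVector n)) :
    ∫ c, inner ℂ u c / inner ℂ v c ∂complexGaussianVector n = inner ℂ u v / inner ℂ v v := by
  have hvv : inner ℂ v v ≠ 0 := inner_self_ne_zero.2 hv
  set κ := inner ℂ u v / inner ℂ v v with hκ
  set w := u - (inner ℂ v u / inner ℂ v v) • v with hw
  have hvw : inner ℂ v w = 0 := by
    rw [hw, inner_sub_right, inner_smul_right, div_mul_cancel₀ _ hvv, sub_self]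
  have hκ' : (starRingEnd ℂ) (inner ℂ v u / inner ℂ v v) = κ := by
    rw [map_div₀, inner_conj_symm, inner_conj_symm]
  have heq : ∀ᵐ c ∂complexGaussianVector n,
      inner ℂ w c / inner ℂ v c = inner ℂ u c / inner ℂ v c - κ := by
    filter_upwards [hne] with c hc
    rw [hw, inner_sub_left, inner_smul_left, hκ', sub_div, mul_div_cancel_right₀ _ hc]
  have h0 := integral_inner_div_inner_of_orthogonal hvw
  rw [integral_congr_ae heq, integral_sub hint (integrable_const _)] at h0
  simpa [sub_eq_zero] using h0

theorem integral_sum_mul_div_sum_mul {n : ℕ} {u v : Fin n → ℂ} (hv : v ≠ 0)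
    (hne : ∀ᵐ c ∂Measure.pi (fun _ : Fin n => stdComplexGaussian), ∑ i, v i * c i ≠ 0)
    (hint : Integrable (fun c : Fin n → ℂ => (∑ i, u i * c i) / ∑ i, v i * c i)
      (Measure.pi (fun _ => stdComplexGaussian))) :
    ∫ c, (∑ i, u i * c i) / (∑ i, v i * c i) ∂Measure.pi (fun _ : Fin n => stdComplexGaussian) =
      (∑ i, u i * (starRingEnd ℂ) (v i)) / ∑ i, v i * (starRingEnd ℂ) (v i) := by
  have hm : MeasurableEmbedding (WithLp.toLp 2 : (Fin n → ℂ) → EuclideanSpace ℂ (Fin n)) :=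
    (MeasurableEquiv.toLp 2 (Fin n → ℂ)).measurableEmbedding
  have key : ∀ (x : Fin n → ℂ) (c : EuclideanSpace ℂ (Fin n)),
      inner ℂ (WithLp.toLp 2 fun i => (starRingEnd ℂ) (x i)) c = ∑ i, x i * c i := by
    intro x c
    simp [PiLp.inner_apply, mul_comm]
  have h := @integral_inner_div_inner n (WithLp.toLp 2 fun i => (starRingEnd ℂ) (u i))
    (WithLp.toLp 2 fun i => (starRingEnd ℂ) (v i)) ?_ ?_ ?_
  · simp_rw [key, complexGaussianVector] at h
    rw [hm.integral_map] at h
    exact h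
  · intro h
    apply hv
    ext i
    have := congrArg (fun x => x i) h
    simpa using this
  · simp_rw [key, complexGaussianVector]
    rw [hm.ae_map_iff]
    exact hne
  · simp_rw [key, complexGaussianVector]
    rw [hm.integrable_map_iff]
    exact hint

/-! ### The Cauchy kernel and integration by parts in the plane. -/

/-- The Jacobian `r` of polar coordinates cancels the singularity. -/
theorem integrable_indicator_ball_inv_norm :
    Integrable ((Metric.ball (0 : ℂ) 1).indicator fun z => ‖z‖⁻¹) := by
  refine ⟨(Measurable.indicator (by fun_prop) Metric.isOpen_ball.measurableSet).aestronglyMeasurable,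
    ?_⟩
  rw [hasFiniteIntegral_iff_enorm, ← Complex.lintegral_comp_polarCoord_symm,
    polarCoord_target]
  refine lt_of_le_of_lt (setLIntegral_mono' (measurableSet_Ioi.prod measurableSet_Ioo)
    (g := (Set.Ioo (0 : ℝ) 1 ×ˢ Set.Ioo (-Real.pi) Real.pi).indicator fun _ => 1) ?_) ?_
  · rintro ⟨r, θ⟩ ⟨hr, hθ⟩
    have hr' : (0 : ℝ) < r := hr
    have hn : ‖Complex.polarCoord.symm (r, θ)‖ = r := by
      rw [Complex.norm_polarCoord_symm, abs_of_pos hr']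
    by_cases h1 : r < 1
    · have hm : (r, θ) ∈ Set.Ioo (0 : ℝ) 1 ×ˢ Set.Ioo (-Real.pi) Real.pi := ⟨⟨hr, h1⟩, hθ⟩
      rw [Set.indicator_of_mem (mem_ball_zero_iff.2 (hn.trans_lt h1)), Set.indicator_of_mem hm, hn,
        Real.enorm_eq_ofReal (by positivity), smul_eq_mul, ← ENNReal.ofReal_mul hr'.le,
        mul_inv_cancel₀ hr'.ne', ENNReal.ofReal_one]
    · rw [Set.indicator_of_notMem (by rwa [mem_ball_zero_iff, hn])]
      simp
  · refine lt_of_le_of_lt (setLIntegral_le_lintegral _ _) ?_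
    rw [lintegral_indicator (measurableSet_Ioo.prod measurableSet_Ioo), setLIntegral_const, one_mul,
      Measure.volume_eq_prod, Measure.prod_prod]
    simp

/-- Split at distance 1 from `w`: near it the kernel is locally integrable, away from it the kernel
is at most 1. That `M` does not depend on `w` matters, since the poles will be random roots. -/
theorem integrable_mul_inv_norm_sub {E : Type*} [NormedAddCommGroup E] {f : ℂ → E}
    (hf : Continuous f) (hc : HasCompactSupport f) :
    ∃ M : ℝ, 0 ≤ M ∧ ∀ w : ℂ, Integrable (fun z => ‖f z‖ * ‖z - w‖⁻¹) ∧
      ∫ z, ‖f z‖ * ‖z - w‖⁻¹ ≤ M := by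
  obtain ⟨D, hD⟩ := hf.bounded_above_of_compact_support hc
  set k := (Metric.ball (0 : ℂ) 1).indicator fun z => ‖z‖⁻¹ with hk
  have hki := integrable_indicator_ball_inv_norm
  have hD0 : 0 ≤ D := (norm_nonneg _).trans (hD 0)
  have hfi : Integrable (fun z => ‖f z‖) :=
    hf.norm.integrable_of_hasCompactSupport hc.norm
  have hk0 : ∀ z, 0 ≤ k z := fun z => Set.indicator_nonneg (fun _ _ => by positivity) _
  have hle : ∀ w z, ‖f z‖ * ‖z - w‖⁻¹ ≤ D * k (z - w) + ‖f z‖ := by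
    intro w z
    by_cases h : ‖z - w‖ < 1
    · rw [hk, Set.indicator_of_mem (by simpa using h)]
      have := mul_le_mul_of_nonneg_right (hD z) (inv_nonneg.2 (norm_nonneg (z - w)))
      linarith [norm_nonneg (f z)]
    · have := mul_le_mul_of_nonneg_left (inv_le_one_of_one_le₀ (not_lt.1 h)) (norm_nonneg (f z))
      linarith [mul_nonneg hD0 (hk0 (z - w))]
  have hint : ∀ w, Integrable (fun z => D * k (z - w) + ‖f z‖) := fun w =>
    ((hki.comp_sub_right w).const_mul D).add hfi
  have hint' : ∀ w, Integrable (fun z => ‖f z‖ * ‖z - w‖⁻¹) := fun w => by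
    refine (hint w).mono' ?_ (Filter.Eventually.of_forall fun z => ?_)
    · exact hf.norm.aestronglyMeasurable.mul (Measurable.aestronglyMeasurable (by fun_prop))
    · rw [Real.norm_of_nonneg (by positivity)]
      exact hle w z
  refine ⟨D * (∫ z, k z) + ∫ z, ‖f z‖, ?_, fun w => ⟨hint' w, ?_⟩⟩
  · exact add_nonneg (mul_nonneg hD0 (integral_nonneg hk0)) (integral_nonneg fun _ => norm_nonneg _)
  · refine (integral_mono (hint' w) (hint w) (hle w)).trans_eq ?_
    rw [integral_add ((hki.comp_sub_right w).const_mul D) hfi, integral_const_mul,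
      integral_sub_right_eq_self k w]

/-- On each ray the integrand times the Jacobian is the derivative of `φ(r e^{iθ}) g(r)`, so only
the value at the origin survives. The case `g = 1` is the fundamental solution of the Laplacian; the
case `g(r) = M(r²)` produces the density. -/
theorem integral_fderiv_radial {φ : ℂ → ℝ} (hφ : ContDiff ℝ 1 φ) (hc : HasCompactSupport φ)
    {g g' : ℝ → ℝ} (hg : ∀ r, HasDerivAt g (g' r) r) (hg' : Continuous g') :
    ∫ z, (fderiv ℝ φ z ((starRingEnd ℂ) z)⁻¹ * g ‖z‖ + φ z * (g' ‖z‖ / ‖z‖)) =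
      -(2 * Real.pi * (φ 0 * g 0)) := by
  set e : ℝ → ℂ := fun θ => Complex.exp (θ * Complex.I) with he
  have hen : ∀ θ, ‖e θ‖ = 1 := fun θ => Complex.norm_exp_ofReal_mul_I θ
  have hgc : Continuous g := continuous_iff_continuousAt.2 fun r => (hg r).continuousAt
  have hdφ : Continuous (fderiv ℝ φ) := hφ.continuous_fderiv one_ne_zero
  set Φ : ℝ × ℝ → ℝ := fun p => fderiv ℝ φ (p.1 * e p.2) (e p.2) * g p.1 + φ (p.1 * e p.2) * g' p.1
    with hΦ
  have hΦc : Continuous Φ := by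
    have := hφ.continuous
    simp only [hΦ, he]
    fun_prop
  obtain ⟨R, hR0, hR⟩ : ∃ R : ℝ, 0 < R ∧ ∀ z, R < ‖z‖ → φ z = 0 ∧ fderiv ℝ φ z = 0 := by
    obtain ⟨R, hR⟩ := hc.isCompact.isBounded.subset_closedBall (0 : ℂ)
    refine ⟨max R 1, by positivity, fun z hz => ?_⟩
    have hz' : z ∉ tsupport φ := fun h => by
      have := hR h
      rw [mem_closedBall_zero_iff] at this
      linarith [le_max_left R 1]
    exact ⟨image_eq_zero_of_notMem_tsupport hz', by
      by_contra h
      exact hz' (support_fderiv_subset ℝ (f := φ) h)⟩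
  have hzero : ∀ r θ, R < r → φ (r * e θ) = 0 ∧ fderiv ℝ φ (r * e θ) = 0 := fun r θ hr => by
    apply hR
    rwa [norm_mul, hen, mul_one, Complex.norm_real, Real.norm_of_nonneg (hR0.trans hr).le]
  have hΦi : IntegrableOn Φ (Set.Ioi 0 ×ˢ Set.Ioo (-Real.pi) Real.pi) := by
    have h1 : IntegrableOn Φ (Set.Icc 0 R ×ˢ Set.Icc (-Real.pi) Real.pi) :=
      hΦc.continuousOn.integrableOn_compact (isCompact_Icc.prod isCompact_Icc)
    refine h1.of_forall_sdiff_eq_zero (measurableSet_Ioi.prod measurableSet_Ioo) ?_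
    rintro ⟨r, θ⟩ ⟨⟨hr, hθ⟩, hn⟩
    have : R < r := by
      by_contra h
      exact hn ⟨⟨le_of_lt hr, not_lt.1 h⟩, Set.Ioo_subset_Icc_self hθ⟩
    simp [hΦ, hzero r θ this]
  have hinner : ∀ θ, ∫ r in Set.Ioi (0 : ℝ), Φ (r, θ) = -(φ 0 * g 0) := by
    intro θ
    have hd : ∀ r : ℝ, HasDerivAt (fun r : ℝ => φ (r * e θ) * g r) (Φ (r, θ)) r := by
      intro r
      have h1 : HasDerivAt (fun r : ℝ => (r : ℂ) * e θ) (e θ) r := by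
        simpa using (Complex.ofRealCLM.hasDerivAt (x := r)).mul_const (e θ)
      have h2 := ((hφ.differentiable one_ne_zero) ((r : ℂ) * e θ)).hasFDerivAt.comp_hasDerivAt r h1
      exact h2.mul (hg r)
    have hi : IntegrableOn (fun r => Φ (r, θ)) (Set.Ioi 0) := by
      have h1 : IntegrableOn (fun r => Φ (r, θ)) (Set.Icc 0 R) :=
        (hΦc.comp (by fun_prop : Continuous fun r : ℝ => (r, θ))).continuousOn.integrableOn_compact
          isCompact_Icc
      refine h1.of_forall_sdiff_eq_zero measurableSet_Ioi ?_
      rintro r ⟨hr, hn⟩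
      have : R < r := by
        by_contra h
        exact hn ⟨le_of_lt hr, not_lt.1 h⟩
      simp [hΦ, hzero r θ this]
    have ht : Filter.Tendsto (fun r : ℝ => φ (r * e θ) * g r) Filter.atTop (nhds 0) := by
      refine tendsto_const_nhds.congr' ?_
      filter_upwards [Filter.eventually_gt_atTop R] with r hr
      simp [hzero r θ hr]
    rw [integral_Ioi_of_hasDerivAt_of_tendsto (hd 0).continuousAt.continuousWithinAt
      (fun r _ => hd r) hi ht]
    simp
  rw [← Complex.integral_comp_polarCoord_symm, polarCoord_target]
  have hcongr : ∫ p in Set.Ioi (0 : ℝ) ×ˢ Set.Ioo (-Real.pi) Real.pi, p.1 •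
      (fderiv ℝ φ (Complex.polarCoord.symm p) ((starRingEnd ℂ) (Complex.polarCoord.symm p))⁻¹ *
        g ‖Complex.polarCoord.symm p‖ + φ (Complex.polarCoord.symm p) *
        (g' ‖Complex.polarCoord.symm p‖ / ‖Complex.polarCoord.symm p‖)) =
      ∫ p in Set.Ioi (0 : ℝ) ×ˢ Set.Ioo (-Real.pi) Real.pi, Φ p := by
    refine setIntegral_congr_fun (measurableSet_Ioi.prod measurableSet_Ioo) ?_
    rintro ⟨r, θ⟩ ⟨hr, -⟩
    have hr' : (0 : ℝ) < r := hr
    have hn : ‖Complex.polarCoord.symm (r, θ)‖ = r := by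
      rw [Complex.norm_polarCoord_symm, abs_of_pos hr']
    have hs : Complex.polarCoord.symm (r, θ) = r * e θ := by
      rw [Complex.polarCoord_symm_apply, he]
      simp only [Complex.exp_mul_I, Complex.ofReal_cos, Complex.ofReal_sin]
    have hinv : ((starRingEnd ℂ) ((r : ℂ) * e θ))⁻¹ = r⁻¹ • e θ := by
      rw [Complex.inv_def, Complex.conj_conj, Complex.normSq_conj, map_mul, Complex.normSq_ofReal,
        Complex.normSq_eq_norm_sq, hen, Complex.real_smul]
      push_cast
      have : (r : ℂ) ≠ 0 := by exact_mod_cast hr'.ne'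
      field_simp
    beta_reduce
    rw [hn]
    simp only [hs, hinv, map_smul, smul_eq_mul, hΦ]
    field_simp
  rw [hcongr, Measure.volume_eq_prod, ← Measure.prod_restrict, integral_prod_symm]
  · simp_rw [hinner]
    rw [setIntegral_const]
    rw [Measure.real, Real.volume_Ioo, ENNReal.toReal_ofReal (by linarith [Real.pi_pos]),
      smul_eq_mul]
    ring
  · rw [Measure.prod_restrict]
    exact hΦi

theorem measurable_fderiv_apply {φ : ℂ → ℝ} (hφ : ContDiff ℝ 1 φ) {α : Type*} [MeasurableSpace α]
    {f h : α → ℂ} (hf : Measurable f) (hh : Measurable h) :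
    Measurable fun a => fderiv ℝ φ (f a) (h a) := by
  have hdφ : Continuous (fderiv ℝ φ) := hφ.continuous_fderiv one_ne_zero
  have hv : ∀ v : ℂ, Measurable fun a => fderiv ℝ φ (f a) v := fun v =>
    (Continuous.measurable (by fun_prop : Continuous fun z => fderiv ℝ φ z v)).comp hf
  have h1 : (fun a => fderiv ℝ φ (f a) (h a)) = fun a =>
      (h a).re * fderiv ℝ φ (f a) 1 + (h a).im * fderiv ℝ φ (f a) Complex.I := by
    ext a
    rw [← smul_eq_mul, ← smul_eq_mul, ← map_smul, ← map_smul, ← map_add]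
    congr 1
    apply Complex.ext <;> simp
  rw [h1]
  exact ((Complex.measurable_re.comp hh).mul (hv 1)).add ((Complex.measurable_im.comp hh).mul (hv _))

theorem integrable_fderiv_inv_conj {φ : ℂ → ℝ} (hφ : ContDiff ℝ 1 φ) (hc : HasCompactSupport φ)
    (w : ℂ) : Integrable fun z => fderiv ℝ φ z ((starRingEnd ℂ) (z - w))⁻¹ := by
  have hdφ : Continuous (fderiv ℝ φ) := hφ.continuous_fderiv one_ne_zero
  obtain ⟨M, -, hM⟩ := integrable_mul_inv_norm_sub hdφ (hc.fderiv ℝ)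
  refine (hM w).1.mono' ?_ (Filter.Eventually.of_forall fun z => ?_)
  · exact (measurable_fderiv_apply hφ measurable_id
      (Complex.continuous_conj.measurable.comp (by fun_prop)).inv).aestronglyMeasurable
  · refine ((fderiv ℝ φ z).le_opNorm _).trans_eq ?_
    rw [norm_inv, Complex.norm_conj]

theorem integral_fderiv_inv_conj {φ : ℂ → ℝ} (hφ : ContDiff ℝ 1 φ) (hc : HasCompactSupport φ)
    (w : ℂ) : ∫ z, fderiv ℝ φ z ((starRingEnd ℂ) (z - w))⁻¹ = -(2 * Real.pi * φ w) := by
  have h := integral_fderiv_radial (φ := fun z => φ (z + w)) (hφ.comp (contDiff_id.add contDiff_const))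
    (hc.comp_homeomorph (Homeomorph.addRight w)) (g := fun _ => 1) (g' := fun _ => 0)
    (fun r => hasDerivAt_const r _) continuous_const
  rw [← integral_add_right_eq_self _ w]
  simpa [fderiv_comp_add_right] using h

/-! ### Sums over roots through the logarithmic derivative. -/

theorem integrable_norm_mul_norm_sum_one_div {E : Type*} [NormedAddCommGroup E] {f : ℂ → E}
    (hf : Continuous f) {M : ℝ}
    (hM : ∀ w : ℂ, Integrable (fun z => ‖f z‖ * ‖z - w‖⁻¹) ∧ ∫ z, ‖f z‖ * ‖z - w‖⁻¹ ≤ M)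
    (s : Multiset ℂ) :
    Integrable (fun z => ‖f z‖ * ‖(s.map fun w => 1 / (z - w)).sum‖) ∧
      ∫ z, ‖f z‖ * ‖(s.map fun w => 1 / (z - w)).sum‖ ≤ s.card * M := by
  have hmeas : ∀ s : Multiset ℂ, Measurable fun z : ℂ => (s.map fun w => 1 / (z - w)).sum := by
    intro s
    induction s using Multiset.induction_on with
    | empty => simp
    | cons w s ih =>
      simp only [Multiset.map_cons, Multiset.sum_cons]
      exact (by fun_prop : Measurable fun z : ℂ => 1 / (z - w)).add ih
  induction s using Multiset.induction_on with
  | empty => simp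
  | cons w s ih =>
    have hle : ∀ z, ‖f z‖ * ‖((w ::ₘ s).map fun w => 1 / (z - w)).sum‖ ≤
        ‖f z‖ * ‖z - w‖⁻¹ + ‖f z‖ * ‖(s.map fun w => 1 / (z - w)).sum‖ := by
      intro z
      rw [← mul_add, Multiset.map_cons, Multiset.sum_cons]
      refine mul_le_mul_of_nonneg_left ((norm_add_le _ _).trans_eq ?_) (norm_nonneg _)
      rw [one_div, norm_inv]
    have hi : Integrable (fun z => ‖f z‖ * ‖((w ::ₘ s).map fun w => 1 / (z - w)).sum‖) := by
      refine ((hM w).1.add ih.1).mono' ?_ (Filter.Eventually.of_forall fun z => ?_)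
      · exact hf.norm.aestronglyMeasurable.mul (hmeas _).norm.aestronglyMeasurable
      · rw [Real.norm_of_nonneg (by positivity)]
        exact hle z
    refine ⟨hi, (integral_mono hi ((hM w).1.add ih.1) hle).trans ?_⟩
    rw [integral_add' (hM w).1 ih.1, Multiset.card_cons]
    push_cast
    linarith [(hM w).2, ih.2]

theorem integral_fderiv_conj_sum_one_div {φ : ℂ → ℝ} (hφ : ContDiff ℝ 1 φ)
    (hc : HasCompactSupport φ) (s : Multiset ℂ) :
    Integrable (fun z => fderiv ℝ φ z ((starRingEnd ℂ) (s.map fun w => 1 / (z - w)).sum)) ∧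
      ∫ z, fderiv ℝ φ z ((starRingEnd ℂ) (s.map fun w => 1 / (z - w)).sum) =
        -(2 * Real.pi * (s.map φ).sum) := by
  induction s using Multiset.induction_on with
  | empty => simp
  | cons w s ih =>
    have h : ∀ z, fderiv ℝ φ z ((starRingEnd ℂ) ((w ::ₘ s).map fun w => 1 / (z - w)).sum) =
        fderiv ℝ φ z ((starRingEnd ℂ) (z - w))⁻¹ +
          fderiv ℝ φ z ((starRingEnd ℂ) (s.map fun w => 1 / (z - w)).sum) := by
      intro z
      rw [Multiset.map_cons, Multiset.sum_cons, map_add, map_add, one_div, map_inv₀]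
    simp_rw [h]
    refine ⟨(integrable_fderiv_inv_conj hφ hc w).add ih.1, ?_⟩
    rw [integral_add (integrable_fderiv_inv_conj hφ hc w) ih.1, ih.2,
      integral_fderiv_inv_conj hφ hc w, Multiset.map_cons, Multiset.sum_cons]
    ring

theorem ae_derivative_div_eq_sum_roots {q : ℂ[X]} (hq : q ≠ 0) :
    ∀ᵐ z : ℂ, q.eval z ≠ 0 ∧
      q.derivative.eval z / q.eval z = (q.roots.map fun w => 1 / (z - w)).sum := by
  have h0 : volume {z : ℂ | q.IsRoot z} = 0 := (finite_setOfPred_isRoot hq).measure_zero _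
  filter_upwards [measure_eq_zero_iff_ae_notMem.1 h0] with z hz
  exact ⟨hz, (IsAlgClosed.splits q).eval_derivative_div_eval_of_ne_zero hz⟩

/-! ### The covariance kernel, its mean, and the candidate density. -/

/-- The weight `C(m + L - 1, m)` of the monomial `z ^ m`. -/
noncomputable def su11Weight (L m : ℕ) : ℝ := (Nat.choose (m + L - 1) m : ℕ)

theorem su11Weight_nonneg (L m : ℕ) : 0 ≤ su11Weight L m := Nat.cast_nonneg _

theorem su11Weight_zero (L : ℕ) : su11Weight L 0 = 1 := by simp [su11Weight]

/-- The covariance `∑_{m ≤ N} C(m + L - 1, m) t^m` of `ψ_N` on the diagonal, with `t = |z|^2`. -/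
noncomputable def su11Kernel (L N : ℕ) : ℝ[X] :=
  ∑ m ∈ Finset.range (N + 1), C (su11Weight L m) * X ^ m

theorem one_le_eval_su11Kernel (L N : ℕ) {t : ℝ} (ht : 0 ≤ t) : 1 ≤ (su11Kernel L N).eval t := by
  rw [su11Kernel, eval_finsetSum, Finset.sum_range_succ']
  simp only [eval_mul, eval_C, eval_pow, eval_X, su11Weight_zero, pow_zero, mul_one]
  have : 0 ≤ ∑ m ∈ Finset.range N, su11Weight L (m + 1) * t ^ (m + 1) :=
    Finset.sum_nonneg fun m _ => mul_nonneg (su11Weight_nonneg _ _) (by positivity)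
  linarith

theorem eval_X_mul_derivative_su11Kernel (L N : ℕ) (t : ℝ) :
    (X * (su11Kernel L N).derivative).eval t =
      ∑ m ∈ Finset.range (N + 1), su11Weight L m * m * t ^ m := by
  rw [su11Kernel, derivative_sum, Finset.mul_sum, eval_finsetSum]
  refine Finset.sum_congr rfl fun m _ => ?_
  rcases m with _ | m
  · simp
  · rw [derivative_C_mul_X_pow]
    simp only [eval_mul, eval_C, eval_pow, eval_X, Nat.add_sub_cancel, pow_succ]
    ring

/-- The mean of `m` under the weights `C(m + L - 1, m) t^m`; it is the expected number of zeros in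
the disc `|z|^2 < t`. -/
noncomputable def su11Mean (L N : ℕ) (t : ℝ) : ℝ :=
  (X * (su11Kernel L N).derivative).eval t / (su11Kernel L N).eval t

/-- The derivative of `su11Mean`. -/
noncomputable def su11MeanDeriv (L N : ℕ) (t : ℝ) : ℝ :=
  ((X * (su11Kernel L N).derivative).derivative.eval t * (su11Kernel L N).eval t -
    (X * (su11Kernel L N).derivative).eval t * (su11Kernel L N).derivative.eval t) /
      (su11Kernel L N).eval t ^ 2

theorem hasDerivAt_su11Mean (L N : ℕ) {t : ℝ} (ht : 0 ≤ t) :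
    HasDerivAt (su11Mean L N) (su11MeanDeriv L N t) t :=
  (Polynomial.hasDerivAt _ t).div (Polynomial.hasDerivAt _ t)
    (by linarith [one_le_eval_su11Kernel L N ht])

theorem continuous_su11MeanDeriv_comp (L N : ℕ) {α : Type*} [TopologicalSpace α] {f : α → ℝ}
    (hf : Continuous f) (h0 : ∀ x, 0 ≤ f x) : Continuous fun x => su11MeanDeriv L N (f x) := by
  unfold su11MeanDeriv
  refine Continuous.div ?_ ?_ fun x => ?_
  · fun_prop
  · fun_prop
  · have := one_le_eval_su11Kernel L N (h0 x)
    positivity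

/-- The density of zeros of `ψ_N`. -/
noncomputable def su11Density (L N : ℕ) (z : ℂ) : ℝ := Real.pi⁻¹ * su11MeanDeriv L N (‖z‖ ^ 2)

theorem continuous_su11Density (L N : ℕ) : Continuous (su11Density L N) :=
  continuous_const.mul (continuous_su11MeanDeriv_comp L N (by fun_prop) fun _ => by positivity)

/-! ### The expected logarithmic derivative of the random polynomial and the density formula. -/

theorem eval_su11Poly (L : ℕ) {N : ℕ} (c : Fin (N + 1) → ℂ) (z : ℂ) :
    (su11Poly L c).eval z = ∑ m : Fin (N + 1), ((√(su11Weight L m) : ℝ) * z ^ (m : ℕ)) * c m := by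
  rw [su11Poly, eval_finsetSum]
  refine Finset.sum_congr rfl fun m _ => ?_
  simp [su11Weight]
  ring

theorem eval_derivative_su11Poly (L : ℕ) {N : ℕ} (c : Fin (N + 1) → ℂ) (z : ℂ) :
    (su11Poly L c).derivative.eval z =
      ∑ m : Fin (N + 1), ((√(su11Weight L m) : ℝ) * (m * z ^ ((m : ℕ) - 1))) * c m := by
  rw [su11Poly, derivative_sum, eval_finsetSum]
  refine Finset.sum_congr rfl fun m _ => ?_
  simp [su11Weight, derivative_X_pow]
  ring

theorem card_roots_su11Poly_le (L : ℕ) {N : ℕ} (c : Fin (N + 1) → ℂ) :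
    (su11Poly L c).roots.card ≤ N := by
  refine (card_roots' _).trans (natDegree_sum_le_of_forall_le _ _ fun m _ => ?_)
  exact (natDegree_C_mul_X_pow_le _ _).trans (Nat.lt_succ_iff.1 m.2)

/-- The constant coefficient has weight 1 and is almost surely nonzero, as the Gaussian law has no
atoms. -/
theorem ae_su11Poly_ne_zero (L N : ℕ) :
    ∀ᵐ c ∂Measure.pi (fun _ : Fin (N + 1) => stdComplexGaussian), su11Poly L c ≠ 0 := by
  have h0 : ∀ᵐ x ∂stdComplexGaussian, x ≠ 0 := by
    simpa using measure_eq_zero_iff_ae_notMem.1 (measure_singleton (μ := stdComplexGaussian) 0)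
  filter_upwards [(measurePreserving_eval (fun _ : Fin (N + 1) => stdComplexGaussian)
    0).quasiMeasurePreserving.ae h0] with c hc h
  apply hc
  have := eval_su11Poly L c 0
  rw [h, Fin.sum_univ_succ] at this
  simpa [su11Weight_zero] using this.symm

theorem integral_derivative_div_su11Poly (L N : ℕ) {z : ℂ} (hz : z ≠ 0)
    (hne : ∀ᵐ c ∂Measure.pi (fun _ : Fin (N + 1) => stdComplexGaussian), (su11Poly L c).eval z ≠ 0)
    (hint : Integrable (fun c => (su11Poly L c).derivative.eval z / (su11Poly L c).eval z)
      (Measure.pi (fun _ : Fin (N + 1) => stdComplexGaussian))) :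
    ∫ c, (su11Poly L c).derivative.eval z / (su11Poly L c).eval z
      ∂Measure.pi (fun _ : Fin (N + 1) => stdComplexGaussian) = z⁻¹ * su11Mean L N (‖z‖ ^ 2) := by
  simp_rw [eval_su11Poly, eval_derivative_su11Poly] at hne hint ⊢
  have hzz : z * (starRingEnd ℂ) z = ((‖z‖ ^ 2 : ℝ) : ℂ) := by
    rw [Complex.mul_conj, Complex.normSq_eq_norm_sq]
  have hs : ∀ m, ((√(su11Weight L m) : ℝ) : ℂ) * (√(su11Weight L m) : ℝ) = su11Weight L m := by
    intro m
    rw [← Complex.ofReal_mul, Real.mul_self_sqrt (su11Weight_nonneg L m)]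
  rw [integral_sum_mul_div_sum_mul _ hne hint]
  · have h1 : ∑ m : Fin (N + 1), ((√(su11Weight L m) : ℝ) * z ^ (m : ℕ)) *
        (starRingEnd ℂ) ((√(su11Weight L m) : ℝ) * z ^ (m : ℕ)) =
        ((su11Kernel L N).eval (‖z‖ ^ 2) : ℝ) := by
      rw [su11Kernel, eval_finsetSum, ← Fin.sum_univ_eq_sum_range
        (fun m => (C (su11Weight L m) * X ^ m : ℝ[X]).eval (‖z‖ ^ 2))]
      push_cast
      refine Finset.sum_congr rfl fun m _ => ?_
      simp only [eval_mul, eval_C, eval_pow, eval_X, Complex.ofReal_mul, Complex.ofReal_pow, map_mul,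
        map_pow, Complex.conj_ofReal]
      rw [← hs, ← Complex.ofReal_pow, ← hzz]
      ring
    have h2 : ∑ m : Fin (N + 1), ((√(su11Weight L m) : ℝ) * (m * z ^ ((m : ℕ) - 1))) *
        (starRingEnd ℂ) ((√(su11Weight L m) : ℝ) * z ^ (m : ℕ)) =
        z⁻¹ * ((X * (su11Kernel L N).derivative).eval (‖z‖ ^ 2) : ℝ) := by
      rw [eval_X_mul_derivative_su11Kernel, ← Fin.sum_univ_eq_sum_range
        (fun m => su11Weight L m * m * (‖z‖ ^ 2) ^ m)]
      push_cast
      rw [Finset.mul_sum]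
      refine Finset.sum_congr rfl fun m _ => ?_
      rw [← hs, ← Complex.ofReal_pow, ← hzz, map_mul, map_pow, Complex.conj_ofReal, mul_pow]
      -- For `m = 0` the truncated exponent `m - 1` is harmless because of the factor `m`.
      rcases Nat.eq_zero_or_pos (m : ℕ) with h | h
      · simp [h]
      · obtain ⟨k, hk⟩ := Nat.exists_eq_add_of_lt h
        rw [hk]
        simp only [zero_add, Nat.add_sub_cancel, pow_succ z]
        field_simp
    rw [h1, h2, su11Mean]
    push_cast
    ring
  · intro h
    have := congrFun h 0
    simp [su11Weight_zero] at this

theorem measurable_eval_su11Poly (L N : ℕ) : Measurable fun x : (Fin (N + 1) → ℂ) × ℂ =>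
    (su11Poly L x.1).eval x.2 := by
  simp_rw [eval_su11Poly]
  fun_prop

theorem measurable_eval_derivative_su11Poly (L N : ℕ) :
    Measurable fun x : (Fin (N + 1) → ℂ) × ℂ => (su11Poly L x.1).derivative.eval x.2 := by
  simp_rw [eval_derivative_su11Poly]
  fun_prop

/-- A nonzero polynomial vanishes on a finite set of `z`; Fubini for null sets exchanges the two
quantifiers. -/
theorem ae_ae_eval_su11Poly_ne_zero (L N : ℕ) :
    ∀ᵐ z : ℂ, ∀ᵐ c ∂Measure.pi (fun _ : Fin (N + 1) => stdComplexGaussian),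
      (su11Poly L c).eval z ≠ 0 := by
  rw [← Measure.ae_ae_comm
    (p := fun (c : Fin (N + 1) → ℂ) (z : ℂ) => (su11Poly L c).eval z ≠ 0)]
  · filter_upwards [ae_su11Poly_ne_zero L N] with c hc
    filter_upwards [ae_derivative_div_eq_sum_roots hc] with z hz
    exact hz.1
  · exact (measurable_eval_su11Poly L N) (measurableSet_singleton 0).compl

/-- Joint integrability for Fubini: the integral over `z` is at most `N * M` for almost every
coefficient vector, because there are at most `N` poles. -/
theorem integrable_norm_mul_norm_derivative_div_su11Poly (L N : ℕ) {E : Type*}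
    [NormedAddCommGroup E] {f : ℂ → E} (hf : Continuous f) (hc : HasCompactSupport f) :
    Integrable (fun x : (Fin (N + 1) → ℂ) × ℂ =>
        ‖f x.2‖ * ‖(su11Poly L x.1).derivative.eval x.2 / (su11Poly L x.1).eval x.2‖)
      ((Measure.pi fun _ : Fin (N + 1) => stdComplexGaussian).prod volume) := by
  obtain ⟨M, hM0, hM⟩ := integrable_mul_inv_norm_sub hf hc
  have hmeas : Measurable (fun x : (Fin (N + 1) → ℂ) × ℂ =>
      ‖f x.2‖ * ‖(su11Poly L x.1).derivative.eval x.2 / (su11Poly L x.1).eval x.2‖) :=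
    (hf.norm.measurable.comp measurable_snd).mul
      ((measurable_eval_derivative_su11Poly L N).div (measurable_eval_su11Poly L N)).norm
  have key : ∀ᵐ c ∂Measure.pi (fun _ : Fin (N + 1) => stdComplexGaussian),
      Integrable (fun z => ‖f z‖ * ‖(su11Poly L c).derivative.eval z / (su11Poly L c).eval z‖) ∧
        ∫ z, ‖f z‖ * ‖(su11Poly L c).derivative.eval z / (su11Poly L c).eval z‖ ≤ N * M := by
    filter_upwards [ae_su11Poly_ne_zero L N] with c hc
    have h := integrable_norm_mul_norm_sum_one_div hf hM (su11Poly L c).roots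
    have hae : (fun z => ‖f z‖ * ‖((su11Poly L c).roots.map fun w => 1 / (z - w)).sum‖) =ᵐ[volume]
        fun z => ‖f z‖ * ‖(su11Poly L c).derivative.eval z / (su11Poly L c).eval z‖ := by
      filter_upwards [ae_derivative_div_eq_sum_roots hc] with z hz
      rw [hz.2]
    refine ⟨h.1.congr hae, ?_⟩
    rw [← integral_congr_ae hae]
    refine h.2.trans (mul_le_mul_of_nonneg_right ?_ hM0)
    exact_mod_cast card_roots_su11Poly_le L c
  rw [integrable_prod_iff hmeas.aestronglyMeasurable]
  refine ⟨key.mono fun c hc => hc.1, (integrable_const (N * M)).mono' ?_ ?_⟩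
  · exact hmeas.norm.stronglyMeasurable.integral_prod_right.aestronglyMeasurable
  · filter_upwards [key] with c hc
    simp only [norm_mul, norm_norm] at hc ⊢
    rw [Real.norm_of_nonneg (integral_nonneg fun _ => by positivity)]
    exact hc.2

theorem integral_fderiv_su11Mean (L N : ℕ) {φ : ℂ → ℝ} (hφ : ContDiff ℝ 1 φ)
    (hc : HasCompactSupport φ) :
    ∫ z, fderiv ℝ φ z ((starRingEnd ℂ) (z⁻¹ * su11Mean L N (‖z‖ ^ 2))) =
      -(2 * Real.pi) * ∫ z, su11Density L N z * φ z := by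
  have hg : ∀ r, HasDerivAt (fun r => su11Mean L N (r ^ 2)) (su11MeanDeriv L N (r ^ 2) * (2 * r))
      r := fun r => by
    have h2 : HasDerivAt (fun r : ℝ => r ^ 2) (2 * r) r := by simpa using hasDerivAt_pow 2 r
    exact HasDerivAt.comp (h₂ := su11Mean L N) r (hasDerivAt_su11Mean L N (sq_nonneg r)) h2
  have hg' : Continuous fun r => su11MeanDeriv L N (r ^ 2) * (2 * r) :=
    (continuous_su11MeanDeriv_comp L N (by fun_prop) fun r => sq_nonneg r).mul (by fun_prop)
  have h := integral_fderiv_radial hφ hc hg hg'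
  -- The mean vanishes at the origin, so the radial formula has no boundary term.
  have h0 : su11Mean L N (0 ^ 2) = 0 := by simp [su11Mean]
  rw [h0, mul_zero, mul_zero, neg_zero] at h
  have hi2 : Integrable fun z => 2 * Real.pi * (su11Density L N z * φ z) :=
    (((continuous_su11Density L N).mul hφ.continuous).integrable_of_hasCompactSupport
      hc.mul_left).const_mul _
  have heq : ∀ᵐ z : ℂ, fderiv ℝ φ z ((starRingEnd ℂ) (z⁻¹ * su11Mean L N (‖z‖ ^ 2))) =
      (fderiv ℝ φ z ((starRingEnd ℂ) z)⁻¹ * su11Mean L N (‖z‖ ^ 2) +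
        φ z * (su11MeanDeriv L N (‖z‖ ^ 2) * (2 * ‖z‖) / ‖z‖)) -
          2 * Real.pi * (su11Density L N z * φ z) := by
    have : ∀ᵐ z : ℂ, z ≠ 0 := by
      simpa using measure_eq_zero_iff_ae_notMem.1 (measure_singleton (μ := (volume : Measure ℂ)) 0)
    filter_upwards [this] with z hz
    have hz' : ‖z‖ ≠ 0 := norm_ne_zero_iff.2 hz
    have h1 : (starRingEnd ℂ) (z⁻¹ * su11Mean L N (‖z‖ ^ 2)) =
        su11Mean L N (‖z‖ ^ 2) • ((starRingEnd ℂ) z)⁻¹ := by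
      rw [map_mul, map_inv₀, Complex.conj_ofReal, Complex.real_smul, mul_comm]
    rw [h1, map_smul, smul_eq_mul, su11Density]
    field_simp
    ring
  have hi1 : Integrable fun z => fderiv ℝ φ z ((starRingEnd ℂ) z)⁻¹ * su11Mean L N (‖z‖ ^ 2) +
        φ z * (su11MeanDeriv L N (‖z‖ ^ 2) * (2 * ‖z‖) / ‖z‖) := by
    have hm : Continuous fun z : ℂ => su11Mean L N (‖z‖ ^ 2) :=
      (continuous_iff_continuousAt.2 fun r => (hg r).continuousAt).comp continuous_norm
    have hd := hφ.continuous_fderiv one_ne_zero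
    have ha : Integrable fun z => su11Mean L N (‖z‖ ^ 2) * fderiv ℝ φ z ((starRingEnd ℂ) z)⁻¹ := by
      obtain ⟨M, -, hM⟩ := integrable_mul_inv_norm_sub (hm.smul hd) ((hc.fderiv ℝ).smul_left)
      refine (hM 0).1.mono' ?_ (Filter.Eventually.of_forall fun z => ?_)
      · exact (hm.measurable.mul (measurable_fderiv_apply hφ measurable_id
          (Complex.continuous_conj.measurable).inv)).aestronglyMeasurable
      · rw [norm_mul, Pi.smul_apply', norm_smul, mul_assoc]
        refine mul_le_mul_of_nonneg_left (((fderiv ℝ φ z).le_opNorm _).trans_eq ?_) (norm_nonneg _)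
        rw [norm_inv, Complex.norm_conj, sub_zero]
    refine (ha.add hi2).congr ?_
    filter_upwards [heq] with z hz
    have hz1 : (starRingEnd ℂ) (z⁻¹ * su11Mean L N (‖z‖ ^ 2)) =
        su11Mean L N (‖z‖ ^ 2) • ((starRingEnd ℂ) z)⁻¹ := by
      rw [map_mul, map_inv₀, Complex.conj_ofReal, Complex.real_smul, mul_comm]
    rw [hz1, map_smul, smul_eq_mul] at hz
    simp only [Pi.add_apply]
    linarith
  rw [integral_congr_ae heq, integral_sub hi1 hi2, h, integral_const_mul]
  ring

theorem integral_sum_roots_su11Poly (L N : ℕ) {φ : ℂ → ℝ} (hφ : ContDiff ℝ 1 φ)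
    (hc : HasCompactSupport φ) :
    Integrable (fun c : Fin (N + 1) → ℂ => ((su11Poly L c).roots.map φ).sum)
        (Measure.pi fun _ => stdComplexGaussian) ∧
      ∫ c : Fin (N + 1) → ℂ, ((su11Poly L c).roots.map φ).sum
          ∂(Measure.pi fun _ => stdComplexGaussian) = ∫ z, su11Density L N z * φ z := by
  set μ := Measure.pi fun _ : Fin (N + 1) => stdComplexGaussian
  set Q : (Fin (N + 1) → ℂ) → ℂ → ℂ :=
    fun c z => (su11Poly L c).derivative.eval z / (su11Poly L c).eval z with hQ
  have hQm : Measurable fun x : (Fin (N + 1) → ℂ) × ℂ => Q x.1 x.2 :=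
    (measurable_eval_derivative_su11Poly L N).div (measurable_eval_su11Poly L N)
  have hH := integrable_norm_mul_norm_derivative_div_su11Poly L N
    (hφ.continuous_fderiv one_ne_zero) (hc.fderiv ℝ)
  have hF : Integrable (fun x : (Fin (N + 1) → ℂ) × ℂ =>
      fderiv ℝ φ x.2 ((starRingEnd ℂ) (Q x.1 x.2))) (μ.prod volume) := by
    refine hH.mono' (measurable_fderiv_apply hφ measurable_snd
      (Complex.continuous_conj.measurable.comp hQm)).aestronglyMeasurable
      (Filter.Eventually.of_forall fun x => ?_)
    refine ((fderiv ℝ φ x.2).le_opNorm _).trans_eq ?_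
    rw [Complex.norm_conj]
  have hroots : (fun c => ((su11Poly L c).roots.map φ).sum) =ᵐ[μ] fun c =>
      -(2 * Real.pi)⁻¹ * ∫ z, fderiv ℝ φ z ((starRingEnd ℂ) (Q c z)) := by
    filter_upwards [ae_su11Poly_ne_zero L N] with c hc'
    have h1 : ∫ z, fderiv ℝ φ z ((starRingEnd ℂ) (Q c z)) = _ :=
      (integral_congr_ae ((ae_derivative_div_eq_sum_roots hc').mono fun z hz => by
        simp only [hQ, hz.2])).trans (integral_fderiv_conj_sum_one_div hφ hc (su11Poly L c).roots).2
    rw [h1]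
    field_simp
  have hE : ∀ᵐ z : ℂ, ∫ c, fderiv ℝ φ z ((starRingEnd ℂ) (Q c z)) ∂μ =
      fderiv ℝ φ z ((starRingEnd ℂ) (z⁻¹ * su11Mean L N (‖z‖ ^ 2))) := by
    have hz0 : ∀ᵐ z : ℂ, z ≠ 0 := by
      simpa using measure_eq_zero_iff_ae_notMem.1 (measure_singleton (μ := (volume : Measure ℂ)) 0)
    filter_upwards [hz0, ae_ae_eval_su11Poly_ne_zero L N, hH.prod_left_ae] with z hz hne hint
    -- Joint integrability controls `ψ'/ψ` only where the differential of `φ` is nonzero; elsewhere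
    -- both sides vanish.
    by_cases hd : fderiv ℝ φ z = 0
    · simp [hd]
    have hm : Measurable fun c => Q c z := hQm.comp (by fun_prop : Measurable fun c => (c, z))
    have hQi : Integrable (fun c => Q c z) μ := by
      rw [← integrable_norm_iff hm.aestronglyMeasurable]
      have := hint.const_mul ‖fderiv ℝ φ z‖⁻¹
      refine this.congr (Filter.Eventually.of_forall fun c => ?_)
      simp only [hQ]
      rw [inv_mul_cancel_left₀ (norm_ne_zero_iff.2 hd)]
    rw [← integral_derivative_div_su11Poly L N hz hne hQi]
    exact (((fderiv ℝ φ z).comp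
      (Complex.conjCLE : ℂ →L[ℝ] ℂ)).integral_comp_comm hQi)
  refine ⟨(hF.integral_prod_left.const_mul _).congr hroots.symm, ?_⟩
  rw [integral_congr_ae hroots, integral_const_mul, integral_integral_swap hF,
    integral_congr_ae hE, integral_fderiv_su11Mean L N hφ hc]
  field_simp

/-! ### Transfer to an arbitrary probability space, and uniqueness. -/

theorem IsIIDStdComplexGaussian.integrable_comp {Ω : Type*} [MeasurableSpace Ω] {P : Measure Ω}
    [IsProbabilityMeasure P] {N : ℕ} {a : Fin (N + 1) → Ω → ℂ} (ha : IsIIDStdComplexGaussian P a)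
    {F : (Fin (N + 1) → ℂ) → ℝ} (hF : Integrable F (Measure.pi fun _ => stdComplexGaussian)) :
    Integrable (fun ω => F fun m => a m ω) P ∧
      ∫ ω, F (fun m => a m ω) ∂P = ∫ c, F c ∂(Measure.pi fun _ => stdComplexGaussian) := by
  have hm : ∀ m, AEMeasurable (a m) P := fun m => (ha.2 m).aemeasurable
  have hlaw := (iIndepFun_iff_map_fun_eq_pi_map hm).1 ha.1
  simp_rw [fun m => (ha.2 m).map_eq] at hlaw
  have hm' : AEMeasurable (fun ω m => a m ω) P := aemeasurable_pi_lambda _ hm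
  rw [← hlaw] at hF ⊢
  exact ⟨(integrable_map_measure hF.aestronglyMeasurable hm').1 hF,
    (integral_map hm' hF.aestronglyMeasurable).symm⟩

theorem isZeroDensity_su11Density (L : ℕ) {N : ℕ} {Ω : Type*} [MeasurableSpace Ω] {P : Measure Ω}
    [IsProbabilityMeasure P] {a : Fin (N + 1) → Ω → ℂ} (ha : IsIIDStdComplexGaussian P a) :
    IsZeroDensity P (fun ω => su11Poly L (fun m => a m ω)) (su11Density L N) := by
  refine ⟨continuous_su11Density L N, fun φ hφ hc => ?_⟩
  have h := integral_sum_roots_su11Poly L N (hφ.of_le (by simp)) hc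
  have h2 := ha.integrable_comp h.1
  exact ⟨h2.1, h2.2.trans h.2⟩

theorem IsZeroDensity.unique {Ω : Type*} [MeasurableSpace Ω] {P : Measure Ω} {ψ : Ω → ℂ[X]}
    {p q : ℂ → ℝ} (hp : IsZeroDensity P ψ p) (hq : IsZeroDensity P ψ q) : p = q := by
  refine Measure.eq_of_ae_eq (μ := (volume : Measure ℂ)) ?_ hp.1 hq.1
  refine ae_eq_of_integral_contDiff_smul_eq hp.1.locallyIntegrable hq.1.locallyIntegrable
    fun φ hφ hc => ?_
  simp_rw [smul_eq_mul, mul_comm (φ _)]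
  rw [← (hp.2 φ hφ hc).2, (hq.2 φ hφ hc).2]

/-! ### Expected number of zeros in a closed annulus. -/

theorem zeroCount_eq_sum_indicator (q : ℂ[X]) (S : Set ℂ) :
    (zeroCount q S : ℝ) = (q.roots.map (S.indicator fun _ => (1 : ℝ))).sum := by
  classical
  rw [zeroCount]
  induction q.roots using Multiset.induction_on with
  | empty => simp
  | cons w s ih =>
    by_cases h : w ∈ S
    · rw [Multiset.filter_cons_of_pos _ h]
      simp [ih, h, add_comm]
    · rw [Multiset.filter_cons_of_neg _ h]
      simp [ih, h]

/-- A smooth approximation from above to the indicator function of `a ≤ |z| ≤ b`. -/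
noncomputable def annulusCutoff (a b : ℝ) (k : ℕ) (z : ℂ) : ℝ :=
  Real.smoothTransition (1 + (k + 1) * (‖z‖ ^ 2 - a ^ 2)) *
    Real.smoothTransition (1 + (k + 1) * (b ^ 2 - ‖z‖ ^ 2))

theorem contDiff_annulusCutoff (a b : ℝ) (k : ℕ) :
    ContDiff ℝ 1 (annulusCutoff a b k) := by
  have h : ContDiff ℝ 1 fun z : ℂ => ‖z‖ ^ 2 := contDiff_norm_sq ℝ
  have hs : ContDiff ℝ 1 Real.smoothTransition := Real.smoothTransition.contDiff
  unfold annulusCutoff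
  exact (hs.comp (by fun_prop)).mul (hs.comp (by fun_prop))

theorem annulusCutoff_nonneg (a b : ℝ) (k : ℕ) (z : ℂ) : 0 ≤ annulusCutoff a b k z :=
  mul_nonneg (Real.smoothTransition.nonneg _) (Real.smoothTransition.nonneg _)

theorem annulusCutoff_le_one (a b : ℝ) (k : ℕ) (z : ℂ) : annulusCutoff a b k z ≤ 1 :=
  mul_le_one₀ (Real.smoothTransition.le_one _) (Real.smoothTransition.nonneg _)
    (Real.smoothTransition.le_one _)

theorem annulusCutoff_eq_zero (a b : ℝ) (k : ℕ) {z : ℂ} (hz : b ^ 2 + 1 ≤ ‖z‖ ^ 2) :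
    annulusCutoff a b k z = 0 := by
  rw [annulusCutoff, Real.smoothTransition.zero_of_nonpos (x := 1 + (k + 1) * (b ^ 2 - ‖z‖ ^ 2)),
    mul_zero]
  have : (0 : ℝ) ≤ k := Nat.cast_nonneg k
  nlinarith

theorem hasCompactSupport_annulusCutoff (a b : ℝ) (k : ℕ) :
    HasCompactSupport (annulusCutoff a b k) := by
  refine HasCompactSupport.intro (isCompact_closedBall (0 : ℂ) (b ^ 2 + 1)) fun z hz => ?_
  apply annulusCutoff_eq_zero
  rw [mem_closedBall_zero_iff, not_le] at hz
  nlinarith [sq_nonneg b]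

theorem tendsto_annulusCutoff {a b : ℝ} (ha : 0 ≤ a) (hb : 0 ≤ b) (z : ℂ) :
    Filter.Tendsto (fun k => annulusCutoff a b k z) Filter.atTop
      (nhds ({z : ℂ | ‖z‖ ∈ Set.Icc a b}.indicator (fun _ => 1) z)) := by
  have hlim : ∀ x : ℝ, x < 0 → ∀ᶠ k : ℕ in Filter.atTop,
      Real.smoothTransition (1 + (k + 1) * x) = 0 := by
    intro x hx
    obtain ⟨n, hn⟩ := exists_nat_ge ((-x)⁻¹)
    filter_upwards [Filter.eventually_ge_atTop n] with k hk
    apply Real.smoothTransition.zero_of_nonpos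
    have h1 : (-x)⁻¹ ≤ (k : ℝ) + 1 := by
      have : (n : ℝ) ≤ k := by exact_mod_cast hk
      linarith
    have h2 : (-x)⁻¹ * (-x) ≤ ((k : ℝ) + 1) * (-x) := mul_le_mul_of_nonneg_right h1 (by linarith)
    rw [inv_mul_cancel₀ (by linarith)] at h2
    linarith
  refine tendsto_const_nhds.congr' ?_
  by_cases hz : ‖z‖ ∈ Set.Icc a b
  · refine Filter.Eventually.of_forall fun k => ?_
    have h1 : a ^ 2 ≤ ‖z‖ ^ 2 := pow_le_pow_left₀ ha hz.1 2
    have h2 : ‖z‖ ^ 2 ≤ b ^ 2 := pow_le_pow_left₀ (norm_nonneg _) hz.2 2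
    have hk : (0 : ℝ) ≤ k := Nat.cast_nonneg k
    have h0 : {z : ℂ | ‖z‖ ∈ Set.Icc a b}.indicator (fun _ => (1 : ℝ)) z = 1 :=
      Set.indicator_of_mem (s := {z : ℂ | ‖z‖ ∈ Set.Icc a b}) hz _
    rw [h0]
    unfold annulusCutoff
    beta_reduce
    rw [Real.smoothTransition.one_of_one_le, Real.smoothTransition.one_of_one_le, mul_one]
    · nlinarith
    · nlinarith
  · rw [Set.indicator_of_notMem (by exact hz)]
    rcases not_and_or.1 hz with h | h
    · filter_upwards [hlim (‖z‖ ^ 2 - a ^ 2) (by nlinarith [norm_nonneg z])] with k hk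
      rw [annulusCutoff, hk, zero_mul]
    · filter_upwards [hlim (b ^ 2 - ‖z‖ ^ 2) (by nlinarith [norm_nonneg z])] with k hk
      rw [annulusCutoff, hk, mul_zero]

theorem integral_su11Density_annulus (L N : ℕ) {a b : ℝ} (ha : 0 ≤ a) (hab : a ≤ b) :
    ∫ z, su11Density L N z * {z : ℂ | ‖z‖ ∈ Set.Icc a b}.indicator (fun _ => 1) z =
      su11Mean L N (b ^ 2) - su11Mean L N (a ^ 2) := by
  have h1 := integral_fun_norm_addHaar (volume : Measure ℂ)
    (fun y : ℝ => Real.pi⁻¹ * su11MeanDeriv L N (y ^ 2) * (Set.Icc a b).indicator (fun _ => 1) y)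
  have hg : ∀ r, HasDerivAt (fun r => su11Mean L N (r ^ 2)) (su11MeanDeriv L N (r ^ 2) * (2 * r))
      r := fun r => by
    have h2 : HasDerivAt (fun r : ℝ => r ^ 2) (2 * r) r := by simpa using hasDerivAt_pow 2 r
    exact HasDerivAt.comp (h₂ := su11Mean L N) r (hasDerivAt_su11Mean L N (sq_nonneg r)) h2
  have hg' : Continuous fun r => su11MeanDeriv L N (r ^ 2) * (2 * r) :=
    (continuous_su11MeanDeriv_comp L N (by fun_prop) fun r => sq_nonneg r).mul (by fun_prop)
  have h2 : ∀ z : ℂ, su11Density L N z * {z : ℂ | ‖z‖ ∈ Set.Icc a b}.indicator (fun _ => 1) z =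
      Real.pi⁻¹ * su11MeanDeriv L N (‖z‖ ^ 2) * (Set.Icc a b).indicator (fun _ => 1) ‖z‖ :=
    fun z => rfl
  simp_rw [h2]
  rw [h1, ← intervalIntegral.integral_eq_sub_of_hasDerivAt (fun r _ => hg r)
    (hg'.intervalIntegrable a b), intervalIntegral.integral_of_le hab, Complex.finrank_real_complex]
  have h3 : ∀ y : ℝ, y ^ (2 - 1) • (Real.pi⁻¹ * su11MeanDeriv L N (y ^ 2) *
      (Set.Icc a b).indicator (fun _ => 1) y) =
      (Set.Icc a b).indicator (fun y => (2 * Real.pi)⁻¹ * (su11MeanDeriv L N (y ^ 2) * (2 * y))) y := by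
    intro y
    by_cases hy : y ∈ Set.Icc a b
    · simp only [Set.indicator_of_mem hy, smul_eq_mul, Nat.add_one_sub_one, pow_one]
      field_simp
    · simp only [Set.indicator_of_notMem hy, mul_zero, smul_zero]
  simp_rw [h3]
  rw [setIntegral_indicator measurableSet_Icc, integral_const_mul]
  have h4 : (Set.Ioi 0 ∩ Set.Icc a b : Set ℝ) =ᵐ[volume] Set.Ioc a b := by
    have h5 : ∀ᵐ y : ℝ, y ≠ a := by
      simpa using measure_eq_zero_iff_ae_notMem.1 (measure_singleton (μ := (volume : Measure ℝ)) a)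
    filter_upwards [h5] with y hy
    apply propext
    constructor
    · rintro ⟨-, h⟩
      exact ⟨lt_of_le_of_ne h.1 hy.symm, h.2⟩
    · rintro h
      exact ⟨ha.trans_lt h.1, h.1.le, h.2⟩
  rw [setIntegral_congr_set h4]
  have h6 : (volume : Measure ℂ).real (Metric.ball 0 1) = Real.pi := by
    simp [Measure.real, Complex.volume_ball]
  rw [h6]
  simp only [nsmul_eq_mul, smul_eq_mul]
  push_cast
  field_simp

/-- The density formula needs differentiable test functions, so the indicator is reached as a limit
of cutoffs. Dominated convergence applies on both sides: root sums are bounded by `N`, and the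
supports lie in one fixed ball. -/
theorem integral_zeroCount_annulus (L N : ℕ) {a b : ℝ} (ha : 0 ≤ a) (hab : a ≤ b) :
    Integrable (fun c : Fin (N + 1) → ℂ =>
        (zeroCount (su11Poly L c) {z | ‖z‖ ∈ Set.Icc a b} : ℝ))
        (Measure.pi fun _ => stdComplexGaussian) ∧
      ∫ c : Fin (N + 1) → ℂ, (zeroCount (su11Poly L c) {z | ‖z‖ ∈ Set.Icc a b} : ℝ)
          ∂(Measure.pi fun _ => stdComplexGaussian) =
        su11Mean L N (b ^ 2) - su11Mean L N (a ^ 2) := by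
  set μ := Measure.pi fun _ : Fin (N + 1) => stdComplexGaussian
  have hb := ha.trans hab
  have hroots := fun k => integral_sum_roots_su11Poly L N (contDiff_annulusCutoff a b k)
    (hasCompactSupport_annulusCutoff a b k)
  have hlim : ∀ c : Fin (N + 1) → ℂ, Filter.Tendsto
      (fun k => ((su11Poly L c).roots.map (annulusCutoff a b k)).sum) Filter.atTop
      (nhds (zeroCount (su11Poly L c) {z | ‖z‖ ∈ Set.Icc a b} : ℝ)) := by
    intro c
    rw [zeroCount_eq_sum_indicator]
    exact tendsto_multiset_sum _ fun z _ => tendsto_annulusCutoff ha hb z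
  have hbound : ∀ k (c : Fin (N + 1) → ℂ),
      ‖((su11Poly L c).roots.map (annulusCutoff a b k)).sum‖ ≤ N := by
    intro k c
    rw [Real.norm_of_nonneg (Multiset.sum_nonneg fun x hx => by
      obtain ⟨z, -, rfl⟩ := Multiset.mem_map.1 hx
      exact annulusCutoff_nonneg _ _ _ _)]
    refine (Multiset.sum_le_card_nsmul _ 1 fun x hx => ?_).trans ?_
    · obtain ⟨z, -, rfl⟩ := Multiset.mem_map.1 hx
      exact annulusCutoff_le_one _ _ _ _
    · rw [Multiset.card_map, nsmul_one]
      exact_mod_cast card_roots_su11Poly_le L c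
  have hmeas : AEStronglyMeasurable (fun c : Fin (N + 1) → ℂ =>
      (zeroCount (su11Poly L c) {z | ‖z‖ ∈ Set.Icc a b} : ℝ)) μ :=
    aestronglyMeasurable_of_tendsto_ae Filter.atTop (fun k => (hroots k).1.aestronglyMeasurable)
      (Filter.Eventually.of_forall hlim)
  refine ⟨(integrable_const (N : ℝ)).mono' hmeas (Filter.Eventually.of_forall fun c =>
    le_of_tendsto (hlim c).norm (Filter.Eventually.of_forall fun k => hbound k c)), ?_⟩
  have h1 := tendsto_integral_of_dominated_convergence (μ := μ) (fun _ => (N : ℝ))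
    (fun k => (hroots k).1.aestronglyMeasurable) (integrable_const _)
    (fun k => Filter.Eventually.of_forall (hbound k)) (Filter.Eventually.of_forall hlim)
  have h2 : Filter.Tendsto (fun k => ∫ z, su11Density L N z * annulusCutoff a b k z) Filter.atTop
      (nhds (∫ z, su11Density L N z * {z : ℂ | ‖z‖ ∈ Set.Icc a b}.indicator (fun _ => 1) z)) := by
    refine tendsto_integral_of_dominated_convergence
      ((Metric.closedBall (0 : ℂ) (b ^ 2 + 1)).indicator fun z => ‖su11Density L N z‖)
      (fun k => ((continuous_su11Density L N).mul
        (contDiff_annulusCutoff a b k).continuous).aestronglyMeasurable) ?_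
      (fun k => Filter.Eventually.of_forall fun z => ?_)
      (Filter.Eventually.of_forall fun z => (tendsto_annulusCutoff ha hb z).const_mul _)
    · rw [integrable_indicator_iff Metric.isClosed_closedBall.measurableSet]
      exact (continuous_su11Density L N).norm.continuousOn.integrableOn_compact
        (isCompact_closedBall _ _)
    · by_cases hz : z ∈ Metric.closedBall (0 : ℂ) (b ^ 2 + 1)
      · rw [Set.indicator_of_mem hz, norm_mul,
          Real.norm_of_nonneg (annulusCutoff_nonneg a b k z)]
        exact mul_le_of_le_one_right (norm_nonneg _) (annulusCutoff_le_one a b k z)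
      · rw [Set.indicator_of_notMem hz, annulusCutoff_eq_zero, mul_zero, norm_zero]
        rw [mem_closedBall_zero_iff, not_le] at hz
        nlinarith [sq_nonneg b]
  rw [← integral_su11Density_annulus L N ha hab]
  refine tendsto_nhds_unique h1 ?_
  exact h2.congr fun k => (hroots k).2.symm

/-! ### Bounds on the mean off the unit circle, and concentration of zeros. -/

theorem succ_mul_su11Weight_succ {L : ℕ} (hL : 1 ≤ L) (m : ℕ) :
    ((m : ℝ) + 1) * su11Weight L (m + 1) = (m + L) * su11Weight L m := by
  obtain ⟨l, rfl⟩ := Nat.exists_eq_add_of_le hL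
  have h := Nat.add_one_mul_choose_eq (m + l) m
  have h1 : m + 1 + (1 + l) - 1 = (m + l).succ := by omega
  have h2 : m + (1 + l) - 1 = m + l := by omega
  rw [su11Weight, su11Weight, h1, h2]
  have h3 : (((m + l).succ : ℕ) : ℝ) * ((m + l).choose m : ℕ) =
      (((m + l).succ.choose m.succ : ℕ) : ℝ) * ((m.succ : ℕ) : ℝ) := by exact_mod_cast h
  push_cast at h3 ⊢
  linarith

theorem su11Weight_le_succ {L : ℕ} (hL : 1 ≤ L) (m : ℕ) :
    su11Weight L m ≤ su11Weight L (m + 1) := by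
  have h := succ_mul_su11Weight_succ hL m
  have hL' : (1 : ℝ) ≤ L := by exact_mod_cast hL
  have h2 : ((m : ℝ) + 1) * su11Weight L m ≤ (m + 1) * su11Weight L (m + 1) := by
    rw [h]
    exact mul_le_mul_of_nonneg_right (by linarith) (su11Weight_nonneg L m)
  exact le_of_mul_le_mul_left h2 (by positivity)

theorem eval_su11Kernel (L N : ℕ) (t : ℝ) :
    (su11Kernel L N).eval t = ∑ m ∈ Finset.range (N + 1), su11Weight L m * t ^ m := by
  simp [su11Kernel, eval_finsetSum]

theorem su11Mean_le_of_lt_one {L : ℕ} (hL : 1 ≤ L) (N : ℕ) {t : ℝ} (h0 : 0 ≤ t) (h1 : t < 1) :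
    su11Mean L N t ≤ L / (1 - t) := by
  have hS := one_le_eval_su11Kernel L N h0
  -- Summation by parts with the weight recurrence; the boundary term has a favourable sign and is
  -- dropped.
  have key : ∀ N : ℕ, (1 - t) * ∑ m ∈ Finset.range (N + 1), su11Weight L m * m * t ^ m =
      L * t * ∑ m ∈ Finset.range (N + 1), su11Weight L m * t ^ m -
        (N + L) * su11Weight L N * t ^ (N + 1) := by
    intro N
    induction N with
    | zero => simp [su11Weight_zero]
    | succ n ih =>
      rw [Finset.sum_range_succ, Finset.sum_range_succ _ (n + 1), mul_add, ih,
        ← succ_mul_su11Weight_succ hL]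
      push_cast
      ring
  rw [su11Mean, eval_X_mul_derivative_su11Kernel, div_le_div_iff₀ (by linarith) (by linarith),
    mul_comm, key, ← eval_su11Kernel]
  have h2 : 0 ≤ ((N : ℝ) + L) * su11Weight L N * t ^ (N + 1) :=
    mul_nonneg (mul_nonneg (by positivity) (su11Weight_nonneg L N)) (by positivity)
  have h3 : L * t * (su11Kernel L N).eval t ≤ L * (su11Kernel L N).eval t :=
    mul_le_mul_of_nonneg_right (mul_le_of_le_one_right (Nat.cast_nonneg _) h1.le) (by linarith)
  linarith

theorem le_su11Mean_of_one_lt {L : ℕ} (hL : 1 ≤ L) (N : ℕ) {t : ℝ} (h1 : 1 < t) :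
    N - 1 / (t - 1) ≤ su11Mean L N t := by
  have hS := one_le_eval_su11Kernel L N (by linarith : 0 ≤ t)
  have ha : ∀ N : ℕ, (t - 1) * ∑ m ∈ Finset.range (N + 1), su11Weight L m * t ^ m ≤
      su11Weight L N * t ^ (N + 1) := by
    intro N
    induction N with
    | zero => simp [su11Weight_zero]
    | succ n ih =>
      rw [Finset.sum_range_succ, mul_add]
      have := mul_le_mul_of_nonneg_right (su11Weight_le_succ hL n)
        (by positivity : 0 ≤ t ^ (n + 1))
      rw [pow_succ t (n + 1)]
      linarith
  -- Passing from `n` to `n + 1` increases the deficit `N K - t K'` by exactly the previous kernel,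
  -- which `ha` and monotone weights bound by the new top term.
  have hb : ∀ N : ℕ, (t - 1) * (N * ∑ m ∈ Finset.range (N + 1), su11Weight L m * t ^ m -
      ∑ m ∈ Finset.range (N + 1), su11Weight L m * m * t ^ m) ≤
        ∑ m ∈ Finset.range (N + 1), su11Weight L m * t ^ m := by
    intro N
    induction N with
    | zero => simp [su11Weight_zero]
    | succ n ih =>
      rw [Finset.sum_range_succ _ (n + 1), Finset.sum_range_succ _ (n + 1)]
      push_cast
      have := mul_le_mul_of_nonneg_right (su11Weight_le_succ hL n)
        (by positivity : 0 ≤ t ^ (n + 1))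
      linarith [ha n]
  have h := hb N
  rw [← eval_su11Kernel, ← eval_X_mul_derivative_su11Kernel] at h
  have h2 : su11Mean L N t * (su11Kernel L N).eval t =
      (X * (su11Kernel L N).derivative).eval t := div_mul_cancel₀ _ (by linarith)
  rw [← h2, ← sub_mul, ← mul_assoc] at h
  have h3 : (t - 1) * (N - su11Mean L N t) ≤ 1 := by
    by_contra h4
    nlinarith
  have h5 : (N : ℝ) - su11Mean L N t ≤ 1 / (t - 1) := by
    rw [le_div_iff₀ (by linarith)]
    linarith
  linarith

theorem exists_annulus_su11Poly {L : ℕ} (hL : 1 ≤ L) {ε : ℝ} (hε : 0 < ε) :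
    ∃ A : ℝ, 0 < A ∧ ∀ N : ℕ, 1 ≤ N →
      Integrable (fun c : Fin (N + 1) → ℂ =>
        (zeroCount (su11Poly L c) {z : ℂ | |‖z‖ - 1| ≤ A / N} : ℝ))
        (Measure.pi fun _ => stdComplexGaussian) ∧
      (1 - ε) * N ≤ ∫ c : Fin (N + 1) → ℂ,
        (zeroCount (su11Poly L c) {z : ℂ | |‖z‖ - 1| ≤ A / N} : ℝ)
          ∂(Measure.pi fun _ => stdComplexGaussian) := by
  have hA : 0 < (L + 1) / ε := by positivity
  -- With `δ = A / N` the losses are at most `L / δ` inside and `1 / δ` outside, and `(L + 1) / δ =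
  -- ε N`.
  refine ⟨(L + 1) / ε, hA, fun N hN => ?_⟩
  set A := (L + 1) / ε with hAdef
  have hN' : (0 : ℝ) < N := by exact_mod_cast hN
  set δ := A / N with hδ
  have hδ0 : 0 < δ := by positivity
  -- For small `N` the width `δ` may exceed 1, so the inner radius is truncated at 0.
  have hset : {z : ℂ | |‖z‖ - 1| ≤ δ} = {z : ℂ | ‖z‖ ∈ Set.Icc (max 0 (1 - δ)) (1 + δ)} := by
    ext z
    simp only [Set.mem_ofPred_eq, Set.mem_Icc, abs_le, max_le_iff]
    constructor
    · rintro ⟨h1, h2⟩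
      exact ⟨⟨norm_nonneg z, by linarith⟩, by linarith⟩
    · rintro ⟨⟨-, h1⟩, h2⟩
      exact ⟨by linarith, by linarith⟩
  rw [hset]
  have h := integral_zeroCount_annulus L N (le_max_left 0 (1 - δ))
    (max_le (by linarith) (by linarith) : max 0 (1 - δ) ≤ 1 + δ)
  refine ⟨h.1, ?_⟩
  rw [h.2]
  have hb : N - 1 / (2 * δ) ≤ su11Mean L N ((1 + δ) ^ 2) := by
    refine le_trans ?_ (le_su11Mean_of_one_lt hL N (by nlinarith))
    have : 1 / ((1 + δ) ^ 2 - 1) ≤ 1 / (2 * δ) :=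
      one_div_le_one_div_of_le (by positivity) (by nlinarith)
    linarith
  have ha : su11Mean L N (max 0 (1 - δ) ^ 2) ≤ L / δ := by
    rcases le_total (1 - δ) 0 with h1 | h1
    · rw [max_eq_left h1]
      have : su11Mean L N (0 ^ 2) = 0 := by simp [su11Mean]
      rw [this]
      positivity
    · rw [max_eq_right h1]
      refine (su11Mean_le_of_lt_one hL N (sq_nonneg _) (by nlinarith)).trans ?_
      exact div_le_div_of_nonneg_left (Nat.cast_nonneg _) hδ0 (by nlinarith)
  have h1 : (L + 1) / δ = ε * N := by
    rw [hδ, hAdef]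
    field_simp
  have h2 : 1 / (2 * δ) ≤ 1 / δ := one_div_le_one_div_of_le hδ0 (by linarith)
  rw [add_div] at h1
  linarith

/-! ### The function `g` and its derivatives as exponential moments. -/

/-- The moments `∫_0^1 x^n e^{sx} dx`. -/
noncomputable def expMoment (n : ℕ) (s : ℝ) : ℝ := ∫ x in (0 : ℝ)..1, x ^ n * Real.exp (s * x)

/-- Viewing `g` as the moment generating function of the uniform law yields all derivatives at once,
including at the removable singularity. -/
theorem expQuot_eq_mgf : expQuot = mgf id ((volume : Measure ℝ).restrict (Set.Ioc 0 1)) := by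
  ext s
  rw [mgf, ← intervalIntegral.integral_of_le zero_le_one, expQuot]
  split_ifs with h
  · simp [h]
  · simp only [id]
    rw [intervalIntegral.integral_comp_mul_left _ h]
    simp
    ring

theorem integrableExpSet_unitInterval :
    integrableExpSet id ((volume : Measure ℝ).restrict (Set.Ioc 0 1)) = Set.univ := by
  refine Set.eq_univ_of_forall fun s => ?_
  have h : IntegrableOn (fun x : ℝ => Real.exp (s * x)) (Set.Icc 0 1) :=
    (by fun_prop : Continuous fun x : ℝ => Real.exp (s * x)).continuousOn.integrableOn_compact
      isCompact_Icc
  exact h.mono_set Set.Ioc_subset_Icc_self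

theorem iteratedDeriv_expQuot (n : ℕ) : iteratedDeriv n expQuot = expMoment n := by
  ext s
  rw [expQuot_eq_mgf, iteratedDeriv_mgf (by simp [integrableExpSet_unitInterval]), expMoment,
    intervalIntegral.integral_of_le zero_le_one]
  rfl

theorem hasDerivAt_expMoment (n : ℕ) (s : ℝ) :
    HasDerivAt (expMoment n) (expMoment (n + 1) s) s := by
  have h := hasDerivAt_iteratedDeriv_mgf (X := id)
    (μ := (volume : Measure ℝ).restrict (Set.Ioc 0 1)) (t := s)
    (by simp [integrableExpSet_unitInterval]) n
  rw [← expQuot_eq_mgf, iteratedDeriv_expQuot] at h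
  rw [expMoment, intervalIntegral.integral_of_le zero_le_one]
  exact h

theorem abs_expMoment_le (n : ℕ) {A s : ℝ} (hA : 0 ≤ A) (hs : |s| ≤ A) :
    |expMoment n s| ≤ Real.exp A := by
  have h := intervalIntegral.norm_integral_le_of_norm_le_const (a := 0) (b := 1)
    (f := fun x : ℝ => x ^ n * Real.exp (s * x)) (C := Real.exp A) fun x hx => by
      rw [Set.uIoc_of_le zero_le_one] at hx
      rw [norm_mul, norm_pow, Real.norm_of_nonneg hx.1.le, Real.norm_of_nonneg (Real.exp_pos _).le]
      have h1 : s * x ≤ A :=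
        (mul_le_mul_of_nonneg_right ((le_abs_self s).trans hs) hx.1.le).trans
          (mul_le_of_le_one_right hA hx.2)
      exact (mul_le_of_le_one_left (Real.exp_pos _).le (pow_le_one₀ hx.1.le hx.2)).trans
        (Real.exp_le_exp.2 h1)
  simpa [expMoment] using h

theorem le_expMoment (n : ℕ) {A s : ℝ} (hA : 0 ≤ A) (hs : |s| ≤ A) :
    Real.exp (-A) / (n + 1) ≤ expMoment n s := by
  have h : ∫ x in (0 : ℝ)..1, x ^ n * Real.exp (-A) ≤ expMoment n s := by
    refine intervalIntegral.integral_mono_on zero_le_one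
      ((by fun_prop : Continuous fun x : ℝ => x ^ n * Real.exp (-A)).intervalIntegrable _ _)
      ((by fun_prop : Continuous fun x : ℝ => x ^ n * Real.exp (s * x)).intervalIntegrable _ _)
      fun x hx => ?_
    have h1 : -A ≤ s * x := by
      have h2 : -A ≤ s := (abs_le.1 hs).1
      nlinarith [hx.1, hx.2]
    exact mul_le_mul_of_nonneg_left (Real.exp_le_exp.2 h1) (pow_nonneg hx.1 n)
  refine le_trans (le_of_eq ?_) h
  rw [intervalIntegral.integral_mul_const, integral_pow]
  simp
  ring

theorem deriv_iteratedDeriv_expQuot_div (k : ℕ) (s : ℝ) :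
    deriv (fun t => iteratedDeriv (k + 1) expQuot t / iteratedDeriv k expQuot t) s =
      (expMoment (k + 2) s * expMoment k s - expMoment (k + 1) s ^ 2) / expMoment k s ^ 2 := by
  have h0 : expMoment k s ≠ 0 := by
    have := le_expMoment k (abs_nonneg s) le_rfl
    have : 0 < Real.exp (-|s|) / (k + 1) := by positivity
    linarith
  rw [iteratedDeriv_expQuot, iteratedDeriv_expQuot,
    ((hasDerivAt_expMoment (k + 1) s).fun_div (hasDerivAt_expMoment k s) h0).deriv]
  ring

/-! ### Convergence of the discrete moments at rate `1 / N`. -/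

theorem abs_pow_mul_exp_sub_le (n : ℕ) {A s x y : ℝ} (hA : 0 ≤ A) (hs : |s| ≤ A)
    (hx : x ∈ Set.Icc (0 : ℝ) 1) (hy : y ∈ Set.Icc (0 : ℝ) 1) :
    |x ^ n * Real.exp (s * x) - y ^ n * Real.exp (s * y)| ≤
      (n + A) * Real.exp A * |x - y| := by
  have hd : ∀ u ∈ Set.Icc (0 : ℝ) 1, HasDerivWithinAt (fun u => u ^ n * Real.exp (s * u))
      (n * u ^ (n - 1) * Real.exp (s * u) + u ^ n * (Real.exp (s * u) * s)) (Set.Icc 0 1) u := by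
    intro u _
    have h1 : HasDerivAt (fun u => Real.exp (s * u)) (Real.exp (s * u) * s) u := by
      simpa using ((hasDerivAt_id u).const_mul s).exp
    exact ((hasDerivAt_pow n u).mul h1).hasDerivWithinAt
  refine (convex_Icc (0 : ℝ) 1).norm_image_sub_le_of_norm_hasDerivWithin_le hd (fun u hu => ?_) hy hx
  have he : Real.exp (s * u) ≤ Real.exp A := by
    refine Real.exp_le_exp.2 ?_
    exact (mul_le_mul_of_nonneg_right ((le_abs_self s).trans hs) hu.1).trans
      (mul_le_of_le_one_right hA hu.2)
  have hu1 : ∀ m : ℕ, u ^ m ≤ 1 := fun m => pow_le_one₀ hu.1 hu.2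
  have hu0 : ∀ m : ℕ, 0 ≤ u ^ m := fun m => pow_nonneg hu.1 m
  refine (norm_add_le _ _).trans ?_
  rw [norm_mul, norm_mul, norm_mul, norm_mul, Real.norm_of_nonneg (hu0 _),
    Real.norm_of_nonneg (hu0 _), Real.norm_of_nonneg (Real.exp_pos _).le, Real.norm_natCast,
    Real.norm_eq_abs s, add_mul]
  refine add_le_add ?_ ?_
  · exact mul_le_mul (mul_le_of_le_one_right (Nat.cast_nonneg _) (hu1 _)) he (Real.exp_pos _).le
      (Nat.cast_nonneg _)
  · calc u ^ n * (Real.exp (s * u) * |s|) ≤ 1 * (Real.exp A * A) :=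
        mul_le_mul (hu1 n) (mul_le_mul he hs (abs_nonneg s) (Real.exp_pos _).le) (by positivity)
          zero_le_one
      _ = A * Real.exp A := by ring

/-- The terms `m < N` form a left Riemann sum of a Lipschitz function; the extra term `m = N` costs
`e^A / N`, whence the `+ 1`. -/
theorem abs_riemannSum_sub_expMoment_le (n : ℕ) {A s : ℝ} (hA : 0 ≤ A) (hs : |s| ≤ A) {N : ℕ}
    (hN : 1 ≤ N) :
    |(N : ℝ)⁻¹ * ∑ m ∈ Finset.range (N + 1), (m / N : ℝ) ^ n * Real.exp (s * (m / N)) -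
      expMoment n s| ≤ (n + A + 1) * Real.exp A / N := by
  have hN0 : (0 : ℝ) < N := by exact_mod_cast hN
  set F : ℝ → ℝ := fun x => x ^ n * Real.exp (s * x) with hF
  have hFc : Continuous F := by fun_prop
  set a : ℕ → ℝ := fun m => (m : ℝ) / N with ha
  have hsum : expMoment n s = ∑ m ∈ Finset.range N, ∫ x in a m..a (m + 1), F x := by
    rw [intervalIntegral.sum_integral_adjacent_intervals fun _ _ => hFc.intervalIntegrable _ _]
    simp [ha, expMoment, hF, hN0.ne']
  have hstep : ∀ m, a (m + 1) - a m = (N : ℝ)⁻¹ := by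
    intro m
    simp only [ha]
    push_cast
    field_simp
    ring
  have hterm : ∀ m ∈ Finset.range N, |(N : ℝ)⁻¹ * F (a m) - ∫ x in a m..a (m + 1), F x| ≤
      (n + A) * Real.exp A * (N : ℝ)⁻¹ * (N : ℝ)⁻¹ := by
    intro m hm
    have hm' : (m : ℝ) + 1 ≤ N := by exact_mod_cast Finset.mem_range.1 hm
    have h0 : 0 ≤ a m := by positivity
    have h1 : a (m + 1) ≤ 1 := by
      simp only [ha]
      rw [div_le_one hN0]
      push_cast
      exact hm'
    have hle : a m ≤ a (m + 1) := by
      have := hstep m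
      have : 0 < (N : ℝ)⁻¹ := by positivity
      linarith
    have h2 : (N : ℝ)⁻¹ * F (a m) - ∫ x in a m..a (m + 1), F x =
        ∫ x in a m..a (m + 1), (F (a m) - F x) := by
      rw [intervalIntegral.integral_sub (by simp) (hFc.intervalIntegrable _ _),
        intervalIntegral.integral_const, hstep, smul_eq_mul]
    rw [h2]
    have h3 := intervalIntegral.norm_integral_le_of_norm_le_const (a := a m) (b := a (m + 1))
      (f := fun x => F (a m) - F x) (C := (n + A) * Real.exp A * (N : ℝ)⁻¹) fun x hx => by
        rw [Set.uIoc_of_le hle] at hx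
        refine (abs_pow_mul_exp_sub_le n hA hs ⟨h0, hle.trans h1⟩
          ⟨h0.trans hx.1.le, hx.2.trans h1⟩).trans ?_
        refine mul_le_mul_of_nonneg_left ?_ (by positivity)
        rw [abs_sub_comm, abs_of_nonneg (by linarith [hx.1]), ← hstep m]
        linarith [hx.2]
    rwa [hstep, abs_of_pos (by positivity : 0 < (N : ℝ)⁻¹)] at h3
  have hlast : |(N : ℝ)⁻¹ * F (a N)| ≤ Real.exp A * (N : ℝ)⁻¹ := by
    have : a N = 1 := by simp [ha, hN0.ne']
    rw [this, abs_mul, abs_of_pos (by positivity : 0 < (N : ℝ)⁻¹), mul_comm]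
    refine mul_le_mul_of_nonneg_right ?_ (by positivity)
    simp only [hF, one_pow, one_mul, mul_one, Real.abs_exp]
    exact Real.exp_le_exp.2 ((le_abs_self s).trans hs)
  have hsplit : (N : ℝ)⁻¹ * ∑ m ∈ Finset.range (N + 1), (m / N : ℝ) ^ n * Real.exp (s * (m / N)) -
      expMoment n s = ∑ m ∈ Finset.range N, ((N : ℝ)⁻¹ * F (a m) - ∫ x in a m..a (m + 1), F x) +
        (N : ℝ)⁻¹ * F (a N) := by
    rw [hsum, Finset.sum_range_succ, Finset.sum_sub_distrib, mul_add, Finset.mul_sum]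
    ring
  rw [hsplit]
  refine (abs_add_le _ _).trans ((add_le_add ((Finset.abs_sum_le_sum_abs _ _).trans
    (Finset.sum_le_sum hterm)) hlast).trans_eq ?_)
  rw [Finset.sum_const, Finset.card_range, nsmul_eq_mul]
  field_simp

/-- The middle quantity is `(m + 1) ⋯ (m + k)`, with `k` factors between `m` and `m + k`. -/
theorem factorial_mul_su11Weight (k m : ℕ) :
    (m : ℝ) ^ k ≤ k.factorial * su11Weight (k + 1) m ∧
      k.factorial * su11Weight (k + 1) m ≤ ((m : ℝ) + k) ^ k := by
  have h : (k.factorial : ℝ) * su11Weight (k + 1) m = ((m + 1).ascFactorial k : ℕ) := by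
    rw [su11Weight, Nat.ascFactorial_eq_factorial_mul_choose, ← Nat.choose_symm_add]
    push_cast
    rfl
  rw [h]
  constructor
  · have h1 : m ^ k ≤ (m + 1).ascFactorial k :=
      (Nat.pow_le_pow_left (Nat.le_succ m) k).trans (Nat.pow_succ_le_ascFactorial (m + 1) k)
    exact_mod_cast h1
  · exact_mod_cast Nat.ascFactorial_le_pow_add m k

theorem abs_normalized_su11Weight_sub_le (k j : ℕ) {N m : ℕ} (hN : 1 ≤ N) (hm : m ≤ N) :
    |k.factorial * su11Weight (k + 1) m * m ^ j / (N : ℝ) ^ (k + j) - (m / N : ℝ) ^ (k + j)| ≤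
      k * k * (1 + k) ^ (k - 1) / N := by
  have hN0 : (0 : ℝ) < N := by exact_mod_cast hN
  have hN1 : (1 : ℝ) ≤ N := by exact_mod_cast hN
  have hx1 : (m / N : ℝ) ≤ 1 := by
    rw [div_le_one hN0]
    exact_mod_cast hm
  have hx0 : 0 ≤ (m / N : ℝ) := by positivity
  obtain ⟨h1, h2⟩ := factorial_mul_su11Weight k m
  have h3 : k.factorial * su11Weight (k + 1) m * m ^ j / (N : ℝ) ^ (k + j) - (m / N : ℝ) ^ (k + j) =
      (k.factorial * su11Weight (k + 1) m / (N : ℝ) ^ k - (m / N : ℝ) ^ k) * (m / N : ℝ) ^ j := by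
    rw [pow_add, pow_add, div_pow, div_pow]
    field_simp
  have h4 : 0 ≤ k.factorial * su11Weight (k + 1) m / (N : ℝ) ^ k - (m / N : ℝ) ^ k := by
    rw [div_pow, ← sub_div]
    exact div_nonneg (by linarith) (by positivity)
  have h5 : k.factorial * su11Weight (k + 1) m / (N : ℝ) ^ k ≤ (m / N + k / N : ℝ) ^ k := by
    rw [← add_div, div_pow]
    exact div_le_div_of_nonneg_right h2 (by positivity)
  have h6 : (m / N + k / N : ℝ) ^ k - (m / N : ℝ) ^ k ≤ k * k * (1 + k) ^ (k - 1) / N := by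
    refine (le_abs_self _).trans ((abs_pow_sub_pow_le _ _ k).trans ?_)
    have hk : (k / N : ℝ) ≤ k := div_le_self (Nat.cast_nonneg _) hN1
    have h7 : max |(m / N + k / N : ℝ)| |(m / N : ℝ)| ≤ 1 + k := by
      rw [abs_of_nonneg (by positivity), abs_of_nonneg hx0]
      exact max_le (by linarith) (by linarith [(Nat.cast_nonneg k : (0 : ℝ) ≤ k)])
    have h8 := pow_le_pow_left₀ (by positivity) h7 (k - 1)
    rw [add_sub_cancel_left, abs_of_nonneg (by positivity : 0 ≤ (k / N : ℝ))]
    calc (k / N : ℝ) * k * max |(m / N + k / N : ℝ)| |(m / N : ℝ)| ^ (k - 1)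
        ≤ (k / N : ℝ) * k * (1 + k) ^ (k - 1) := mul_le_mul_of_nonneg_left h8 (by positivity)
      _ = _ := by ring
  rw [h3, abs_mul, abs_of_nonneg h4, abs_of_nonneg (pow_nonneg hx0 j)]
  refine (mul_le_of_le_one_right h4 (pow_le_one₀ hx0 hx1)).trans ?_
  linarith

theorem one_add_div_pow_le_exp {A s : ℝ} (hA : 0 ≤ A) (hs : |s| ≤ A) {N m : ℕ} (hN : 1 ≤ N)
    (hm : m ≤ N) (h0 : 0 ≤ 1 + s / N) : (1 + s / N) ^ m ≤ Real.exp A := by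
  have hN0 : (0 : ℝ) < N := by exact_mod_cast hN
  have h1 : 1 + s / N ≤ Real.exp (A / N) := by
    have : s / N ≤ A / N := div_le_div_of_nonneg_right ((le_abs_self s).trans hs) hN0.le
    linarith [Real.add_one_le_exp (A / N)]
  refine (pow_le_pow_left₀ h0 h1 m).trans ?_
  rw [← Real.exp_nat_mul]
  refine Real.exp_le_exp.2 ?_
  have hm' : (m : ℝ) ≤ N := by exact_mod_cast hm
  calc (m : ℝ) * (A / N) ≤ N * (A / N) := mul_le_mul_of_nonneg_right hm' (by positivity)
    _ = A := by field_simp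

/-- One factor `1 + s/N` differs from `e^{s/N}` by at most `(A/N)²`, and at most `N` factors are
exchanged. -/
theorem abs_one_add_div_pow_sub_exp_le {A s : ℝ} (hA : 0 ≤ A) (hs : |s| ≤ A) {N m : ℕ} (hN : 1 ≤ N)
    (hm : m ≤ N) (hAN : A ≤ N) :
    |(1 + s / N) ^ m - Real.exp (s * (m / N))| ≤ A ^ 2 * Real.exp A / N := by
  have hN0 : (0 : ℝ) < N := by exact_mod_cast hN
  have hsN : |s / N| ≤ A / N := by
    rw [abs_div, abs_of_pos hN0]
    exact div_le_div_of_nonneg_right hs hN0.le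
  have hAN1 : A / N ≤ 1 := (div_le_one hN0).2 hAN
  have h0 : 0 ≤ 1 + s / N := by linarith [(abs_le.1 hsN).1]
  have h1 : |(1 + s / N) - Real.exp (s / N)| ≤ (A / N) ^ 2 := by
    have := Real.abs_exp_sub_one_sub_id_le (hsN.trans hAN1)
    rw [abs_sub_comm, ← sub_sub]
    exact this.trans (sq_le_sq' (by linarith [(abs_le.1 hsN).1]) (abs_le.1 hsN).2)
  have h2 : max |1 + s / N| |Real.exp (s / N)| ≤ Real.exp (A / N) := by
    rw [abs_of_nonneg h0, Real.abs_exp]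
    have h3 : Real.exp (s / N) ≤ Real.exp (A / N) := Real.exp_le_exp.2 (abs_le.1 hsN).2
    exact max_le (by linarith [Real.add_one_le_exp (s / N)]) h3
  have h4 : max |1 + s / N| |Real.exp (s / N)| ^ (m - 1) ≤ Real.exp A := by
    refine (pow_le_pow_left₀ (by positivity) h2 _).trans ?_
    rw [← Real.exp_nat_mul]
    refine Real.exp_le_exp.2 ?_
    have hm' : ((m - 1 : ℕ) : ℝ) ≤ N := by exact_mod_cast (Nat.sub_le m 1).trans hm
    calc ((m - 1 : ℕ) : ℝ) * (A / N) ≤ N * (A / N) :=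
          mul_le_mul_of_nonneg_right hm' (by positivity)
      _ = A := by field_simp
  have h5 : Real.exp (s * (m / N)) = Real.exp (s / N) ^ m := by
    rw [← Real.exp_nat_mul]
    congr 1
    ring
  have hm' : (m : ℝ) ≤ N := by exact_mod_cast hm
  rw [h5]
  refine (abs_pow_sub_pow_le _ _ m).trans ?_
  calc |(1 + s / N) - Real.exp (s / N)| * m * max |1 + s / N| |Real.exp (s / N)| ^ (m - 1)
      ≤ (A / N) ^ 2 * N * Real.exp A :=
        mul_le_mul (mul_le_mul h1 hm' (Nat.cast_nonneg _) (by positivity)) h4 (by positivity)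
          (by positivity)
    _ = A ^ 2 * Real.exp A / N := by field_simp

/-- The `j`-th moment of `m` under the weights `C(m + k, m) (1 + s/N)^m`, scaled to converge to
`∫_0^1 x^(k+j) e^{sx} dx`. -/
noncomputable def su11Moment (k j N : ℕ) (s : ℝ) : ℝ :=
  (k.factorial / (N : ℝ) ^ (k + j + 1)) *
    ∑ m ∈ Finset.range (N + 1), su11Weight (k + 1) m * m ^ j * (1 + s / N) ^ m

theorem exists_abs_su11Moment_sub_expMoment_le (k j : ℕ) {A : ℝ} (hA : 0 ≤ A) :
    ∃ C : ℝ, 0 ≤ C ∧ ∀ N : ℕ, 1 ≤ N → A ≤ N → ∀ s : ℝ, |s| ≤ A →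
      |su11Moment k j N s - expMoment (k + j) s| ≤ C / N := by
  set C₁ : ℝ := k * k * (1 + k) ^ (k - 1) with hC₁
  set D : ℝ := C₁ * Real.exp A + A ^ 2 * Real.exp A with hD
  -- Each of the `N + 1` terms errs by `D / N`, and `(N + 1) / N ≤ 2`; the remainder is the Riemann
  -- sum error.
  refine ⟨2 * D + (((k + j : ℕ) : ℝ) + A + 1) * Real.exp A, by positivity, fun N hN hAN s hs => ?_⟩
  have hN0 : (0 : ℝ) < N := by exact_mod_cast hN
  have hN1 : (1 : ℝ) ≤ N := by exact_mod_cast hN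
  have h0 : 0 ≤ 1 + s / N := by
    have : -A / N ≤ s / N := div_le_div_of_nonneg_right (abs_le.1 hs).1 hN0.le
    have : A / N ≤ 1 := (div_le_one hN0).2 hAN
    rw [neg_div] at *
    linarith
  have hterm : ∀ m ∈ Finset.range (N + 1),
      |k.factorial * su11Weight (k + 1) m * m ^ j / (N : ℝ) ^ (k + j) * (1 + s / N) ^ m -
        (m / N : ℝ) ^ (k + j) * Real.exp (s * (m / N))| ≤ D / N := by
    intro m hm
    have hm' : m ≤ N := Nat.lt_succ_iff.1 (Finset.mem_range.1 hm)
    have h1 := abs_normalized_su11Weight_sub_le k j hN hm'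
    have h2 := abs_one_add_div_pow_sub_exp_le hA hs hN hm' hAN
    have h3 := one_add_div_pow_le_exp hA hs hN hm' h0
    have hx1 : (m / N : ℝ) ≤ 1 := by
      rw [div_le_one hN0]
      exact_mod_cast hm'
    have hx2 : (m / N : ℝ) ^ (k + j) ≤ 1 := pow_le_one₀ (by positivity) hx1
    have hx0 : 0 ≤ (m / N : ℝ) ^ (k + j) := by positivity
    generalize k.factorial * su11Weight (k + 1) m * m ^ j / (N : ℝ) ^ (k + j) = a at h1 ⊢
    generalize (m / N : ℝ) ^ (k + j) = c at h1 hx2 hx0 ⊢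
    have h4 : 0 ≤ (1 + s / N) ^ m := pow_nonneg h0 m
    generalize (1 + s / N) ^ m = b at h2 h3 h4 ⊢
    generalize Real.exp (s * (m / N)) = d at h2 ⊢
    calc |a * b - c * d| = |(a - c) * b + c * (b - d)| := by ring_nf
      _ ≤ |a - c| * b + c * |b - d| := by
        refine (abs_add_le _ _).trans_eq ?_
        rw [abs_mul, abs_mul, abs_of_nonneg h4, abs_of_nonneg hx0]
      _ ≤ C₁ / N * Real.exp A + 1 * (A ^ 2 * Real.exp A / N) :=
        add_le_add (mul_le_mul h1 h3 h4 (by positivity))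
          (mul_le_mul hx2 h2 (abs_nonneg _) zero_le_one)
      _ = D / N := by
        rw [hD]
        ring
  have hsum : |su11Moment k j N s -
      (N : ℝ)⁻¹ * ∑ m ∈ Finset.range (N + 1), (m / N : ℝ) ^ (k + j) * Real.exp (s * (m / N))| ≤
        2 * D / N := by
    have h1 : su11Moment k j N s = (N : ℝ)⁻¹ * ∑ m ∈ Finset.range (N + 1),
        k.factorial * su11Weight (k + 1) m * m ^ j / (N : ℝ) ^ (k + j) * (1 + s / N) ^ m := by
      rw [su11Moment, Finset.mul_sum, Finset.mul_sum]
      refine Finset.sum_congr rfl fun m _ => ?_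
      rw [pow_succ]
      field_simp
    rw [h1, ← mul_sub, ← Finset.sum_sub_distrib, abs_mul, abs_of_pos (by positivity : 0 < (N : ℝ)⁻¹)]
    refine (mul_le_mul_of_nonneg_left ((Finset.abs_sum_le_sum_abs _ _).trans
      (Finset.sum_le_sum hterm)) (by positivity)).trans ?_
    rw [Finset.sum_const, Finset.card_range, nsmul_eq_mul]
    push_cast
    have h5 : (N : ℝ)⁻¹ * (N + 1) ≤ 2 := by
      rw [inv_mul_le_iff₀ hN0]
      linarith
    calc (N : ℝ)⁻¹ * ((N + 1) * (D / N)) = (N : ℝ)⁻¹ * (N + 1) * (D / N) := by ring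
      _ ≤ 2 * (D / N) := mul_le_mul_of_nonneg_right h5 (by positivity)
      _ = 2 * D / N := by ring
  have h6 := abs_riemannSum_sub_expMoment_le (k + j) hA hs hN
  refine (abs_sub_le _ _ _).trans ((add_le_add hsum h6).trans_eq ?_)
  ring

/-- Since `t d/dt` multiplies `t^m` by `m`, `t M'(t)` is the variance of `m`; the factorials and
powers of `N` cancel in the quotient. -/
theorem su11MeanDeriv_eq_su11Moment (k : ℕ) {N : ℕ} (hN : 1 ≤ N) {s : ℝ} (h0 : 0 < 1 + s / N) :
    ((N : ℝ) ^ 2)⁻¹ * su11MeanDeriv (k + 1) N (1 + s / N) =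
      (su11Moment k 2 N s * su11Moment k 0 N s - su11Moment k 1 N s ^ 2) /
        ((1 + s / N) * su11Moment k 0 N s ^ 2) := by
  have hN0 : (0 : ℝ) < N := by exact_mod_cast hN
  set t := 1 + s / N with ht
  have hK := one_le_eval_su11Kernel (k + 1) N h0.le
  have e0 : su11Moment k 0 N s = k.factorial / (N : ℝ) ^ (k + 1) * (su11Kernel (k + 1) N).eval t := by
    rw [su11Moment, ← ht, eval_su11Kernel]
    simp
  have e1 : su11Moment k 1 N s = k.factorial / (N : ℝ) ^ (k + 2) *
      (X * (su11Kernel (k + 1) N).derivative).eval t := by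
    rw [su11Moment, ← ht, eval_X_mul_derivative_su11Kernel]
    simp
  have e2 : su11Moment k 2 N s = k.factorial / (N : ℝ) ^ (k + 3) *
      (t * (X * (su11Kernel (k + 1) N).derivative).derivative.eval t) := by
    have h1 : X * (su11Kernel (k + 1) N).derivative =
        ∑ m ∈ Finset.range (N + 1), C (su11Weight (k + 1) m * m) * X ^ m := by
      rw [su11Kernel, derivative_sum, Finset.mul_sum]
      refine Finset.sum_congr rfl fun m _ => ?_
      rw [derivative_C_mul_X_pow]
      rcases m with _ | m
      · simp
      · rw [Nat.add_sub_cancel, pow_succ]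
        ring
    rw [su11Moment, ← ht, h1, derivative_sum, eval_finsetSum, Finset.mul_sum (a := t)]
    congr 1
    refine Finset.sum_congr rfl fun m _ => ?_
    rw [derivative_C_mul_X_pow]
    rcases m with _ | m
    · simp
    · simp only [eval_mul, eval_C, eval_pow, eval_X, Nat.add_sub_cancel, pow_succ]
      ring
  have e3 : (X * (su11Kernel (k + 1) N).derivative).eval t =
      t * (su11Kernel (k + 1) N).derivative.eval t := by simp
  have hf : (k.factorial : ℝ) ≠ 0 := by exact_mod_cast k.factorial_ne_zero
  rw [e0, e1, e2, su11MeanDeriv, e3]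
  generalize (su11Kernel (k + 1) N).eval t = K at hK ⊢
  generalize (X * (su11Kernel (k + 1) N).derivative).derivative.eval t = K₂
  generalize (su11Kernel (k + 1) N).derivative.eval t = K₁
  have hK0 : K ≠ 0 := by linarith
  have ht0 : t ≠ 0 := h0.ne'
  field_simp
  ring

/-! ### The scaling limit of the density with rate. -/

theorem abs_variance_quotient_sub_le {b B e t I₀ I₁ I₂ M₀ M₁ M₂ : ℝ} (hb : 0 < b) (he : 0 ≤ e)
    (he1 : e ≤ 1) (hI₀ : |I₀| ≤ B) (hI₁ : |I₁| ≤ B) (hI₂ : |I₂| ≤ B) (hbI : b ≤ I₀)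
    (hbM : b / 2 ≤ M₀) (ht : 1 / 2 ≤ t) (ht1 : |t - 1| ≤ e) (h₀ : |M₀ - I₀| ≤ e)
    (h₁ : |M₁ - I₁| ≤ e) (h₂ : |M₂ - I₂| ≤ e) :
    |(M₂ * M₀ - M₁ ^ 2) / (t * M₀ ^ 2) - (I₂ * I₀ - I₁ ^ 2) / I₀ ^ 2| ≤
      ((4 * B + 2) * B ^ 2 + 2 * B ^ 2 * ((B + 1) ^ 2 + (2 * B + 1))) / (b ^ 4 / 8) * e := by
  have hB : 0 ≤ B := (abs_nonneg _).trans hI₀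
  have hM : ∀ {M I : ℝ}, |I| ≤ B → |M - I| ≤ e → |M| ≤ B + 1 := fun {M I} h h' => by
    have := abs_sub_abs_le_abs_sub M I
    linarith
  have hM₀ := hM hI₀ h₀
  have hM₁ := hM hI₁ h₁
  have hE : |(M₂ * M₀ - M₁ ^ 2) - (I₂ * I₀ - I₁ ^ 2)| ≤ (4 * B + 2) * e := by
    have h1 : (M₂ * M₀ - M₁ ^ 2) - (I₂ * I₀ - I₁ ^ 2) =
        (M₂ - I₂) * M₀ + I₂ * (M₀ - I₀) - (M₁ - I₁) * (M₁ + I₁) := by ring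
    have h2 : |(M₂ - I₂) * M₀| ≤ e * (B + 1) := by
      rw [abs_mul]
      exact mul_le_mul h₂ hM₀ (abs_nonneg _) he
    have h3 : |I₂ * (M₀ - I₀)| ≤ B * e := by
      rw [abs_mul]
      exact mul_le_mul hI₂ h₀ (abs_nonneg _) hB
    have h4 : |(M₁ - I₁) * (M₁ + I₁)| ≤ e * (2 * B + 1) := by
      rw [abs_mul]
      exact mul_le_mul h₁ (by linarith [abs_add_le M₁ I₁]) (abs_nonneg _) he
    rw [h1]
    refine (abs_sub _ _).trans ?_
    linarith [abs_add_le ((M₂ - I₂) * M₀) (I₂ * (M₀ - I₀))]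
  have hT : |t * M₀ ^ 2 - I₀ ^ 2| ≤ ((B + 1) ^ 2 + (2 * B + 1)) * e := by
    have h1 : t * M₀ ^ 2 - I₀ ^ 2 = (t - 1) * M₀ ^ 2 + (M₀ - I₀) * (M₀ + I₀) := by ring
    have h2 : |(t - 1) * M₀ ^ 2| ≤ e * (B + 1) ^ 2 := by
      rw [abs_mul, abs_pow]
      exact mul_le_mul ht1 (pow_le_pow_left₀ (abs_nonneg _) hM₀ 2) (by positivity) he
    have h3 : |(M₀ - I₀) * (M₀ + I₀)| ≤ e * (2 * B + 1) := by
      rw [abs_mul]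
      exact mul_le_mul h₀ (by linarith [abs_add_le M₀ I₀]) (abs_nonneg _) he
    rw [h1]
    refine (abs_add_le _ _).trans ?_
    linarith
  have hW : |I₂ * I₀ - I₁ ^ 2| ≤ 2 * B ^ 2 := by
    refine (abs_sub _ _).trans ?_
    rw [abs_mul, abs_pow]
    have h1 := mul_le_mul hI₂ hI₀ (abs_nonneg _) hB
    have h2 := pow_le_pow_left₀ (abs_nonneg _) hI₁ 2
    linarith
  have hI2 : |I₀ ^ 2| ≤ B ^ 2 := by
    rw [abs_pow]
    exact pow_le_pow_left₀ (abs_nonneg _) hI₀ 2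
  -- The three lower bounds multiply to `1/2 * (b/2)² * b²`.
  have hden : b ^ 4 / 8 ≤ t * M₀ ^ 2 * I₀ ^ 2 := by
    have h1 : (b / 2) ^ 2 ≤ M₀ ^ 2 := pow_le_pow_left₀ (by positivity) hbM 2
    have h2 : b ^ 2 ≤ I₀ ^ 2 := pow_le_pow_left₀ hb.le hbI 2
    have h3 : 1 / 2 * (b / 2) ^ 2 ≤ t * M₀ ^ 2 := mul_le_mul ht h1 (by positivity) (by linarith)
    calc b ^ 4 / 8 = 1 / 2 * (b / 2) ^ 2 * b ^ 2 := by ring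
      _ ≤ _ := mul_le_mul h3 h2 (by positivity) (by linarith [sq_nonneg (b / 2)])
  have hM₀' : 0 < M₀ := by linarith
  have hI₀' : 0 < I₀ := by linarith
  have ht' : 0 < t := by linarith
  have hkey : (M₂ * M₀ - M₁ ^ 2) / (t * M₀ ^ 2) - (I₂ * I₀ - I₁ ^ 2) / I₀ ^ 2 =
      (((M₂ * M₀ - M₁ ^ 2) - (I₂ * I₀ - I₁ ^ 2)) * I₀ ^ 2 -
        (I₂ * I₀ - I₁ ^ 2) * (t * M₀ ^ 2 - I₀ ^ 2)) / (t * M₀ ^ 2 * I₀ ^ 2) := by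
    field_simp
    ring
  rw [hkey, abs_div, abs_of_pos (by positivity : 0 < t * M₀ ^ 2 * I₀ ^ 2), div_mul_eq_mul_div]
  refine div_le_div₀ (by positivity) ?_ (by positivity) hden
  refine (abs_sub _ _).trans ?_
  rw [abs_mul, abs_mul]
  have h1 := mul_le_mul hE hI2 (abs_nonneg _) (by positivity)
  have h2 := mul_le_mul hW hT (abs_nonneg _) (by positivity)
  linarith

theorem exists_su11MeanDeriv_sub_le_of_ge (k : ℕ) {A : ℝ} (hA : 0 < A) :
    ∃ C : ℝ, 0 ≤ C ∧ ∃ N₀ : ℕ, ∀ N : ℕ, N₀ ≤ N → ∀ s : ℝ, |s| ≤ A →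
      |((N : ℝ) ^ 2)⁻¹ * su11MeanDeriv (k + 1) N (1 + s / N) -
        (expMoment (k + 2) s * expMoment k s - expMoment (k + 1) s ^ 2) / expMoment k s ^ 2| ≤
          C / N := by
  obtain ⟨C₀, hC₀, h₀⟩ := exists_abs_su11Moment_sub_expMoment_le k 0 hA.le
  obtain ⟨C₁, hC₁, h₁⟩ := exists_abs_su11Moment_sub_expMoment_le k 1 hA.le
  obtain ⟨C₂, hC₂, h₂⟩ := exists_abs_su11Moment_sub_expMoment_le k 2 hA.le
  set b := Real.exp (-A) / ((k : ℝ) + 1) with hb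
  set B := Real.exp A with hB
  have hb0 : 0 < b := by positivity
  set E := C₀ + C₁ + C₂ + 2 * A with hE
  set Q := ((4 * B + 2) * B ^ 2 + 2 * B ^ 2 * ((B + 1) ^ 2 + (2 * B + 1))) / (b ^ 4 / 8) with hQ
  -- This size of `N` gives `E / N ≤ 1` and `E / N ≤ b / 2`, keeping the discrete moment above `b /
  -- 2`; the summand `2 * A` of `E` gives `1 + s/N ≥ 1/2`.
  obtain ⟨N₀, hN₀⟩ := exists_nat_ge (1 + E + E / (b / 2))
  refine ⟨Q * E, by positivity, N₀, fun N hN s hs => ?_⟩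
  have hNE : 1 + E + E / (b / 2) ≤ N := hN₀.trans (by exact_mod_cast hN)
  have hE0 : 0 ≤ E := by positivity
  have hEb : 0 ≤ E / (b / 2) := by positivity
  have hN1 : (1 : ℝ) ≤ N := by linarith
  have hN1' : 1 ≤ N := by exact_mod_cast hN1
  have hN0 : (0 : ℝ) < N := by linarith
  have hAN : A ≤ N := by linarith
  have hle : ∀ {x : ℝ}, x ≤ E → x / N ≤ E / N := fun h => div_le_div_of_nonneg_right h hN0.le
  have he1 : E / N ≤ 1 := (div_le_one hN0).2 (by linarith)
  have heb : E / N ≤ b / 2 := by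
    rw [div_le_comm₀ hN0 (by positivity)]
    linarith
  have ht1 : |1 + s / N - 1| ≤ A / N := by
    rw [add_sub_cancel_left, abs_div, abs_of_pos hN0]
    exact div_le_div_of_nonneg_right hs hN0.le
  have ht : 1 / 2 ≤ 1 + s / N := by
    have h2A : A / N ≤ 1 / 2 := by
      rw [div_le_iff₀ hN0]
      linarith
    linarith [(abs_le.1 ht1).1]
  have hI := le_expMoment k hA.le hs
  have hM₀ := (h₀ N hN1' hAN s hs).trans (hle (by linarith))
  rw [add_zero] at hM₀
  rw [su11MeanDeriv_eq_su11Moment k hN1' (by linarith), mul_div_assoc]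
  exact abs_variance_quotient_sub_le hb0 (by positivity) he1 (abs_expMoment_le _ hA.le hs)
    (abs_expMoment_le _ hA.le hs) (abs_expMoment_le _ hA.le hs) hI
    (by linarith [(abs_le.1 hM₀).1]) ht (ht1.trans (hle (by linarith))) hM₀
    ((h₁ N hN1' hAN s hs).trans (hle (by linarith)))
    ((h₂ N hN1' hAN s hs).trans (hle (by linarith)))

/-- Only finitely many `N` lie below the threshold, and for each the error is bounded by
compactness. Replacing `1 + s/N` by its positive part keeps the expression continuous on all of
`[-A, A]`. -/
theorem exists_su11MeanDeriv_sub_le (k : ℕ) {A : ℝ} (hA : 0 < A) :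
    ∃ C : ℝ, 0 < C ∧ ∀ N : ℕ, 1 ≤ N → ∀ s : ℝ, |s| ≤ A → 0 ≤ 1 + s / N →
      |((N : ℝ) ^ 2)⁻¹ * su11MeanDeriv (k + 1) N (1 + s / N) -
        (expMoment (k + 2) s * expMoment k s - expMoment (k + 1) s ^ 2) / expMoment k s ^ 2| ≤
          C / N := by
  obtain ⟨C, hC, N₀, h⟩ := exists_su11MeanDeriv_sub_le_of_ge k hA
  have hcont : ∀ n, Continuous (expMoment n) := fun n =>
    continuous_iff_continuousAt.2 fun s => (hasDerivAt_expMoment n s).continuousAt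
  have hbdd : ∀ N : ℕ, ∃ D : ℝ, ∀ s ∈ Set.Icc (-A) A,
      ‖((N : ℝ) ^ 2)⁻¹ * su11MeanDeriv (k + 1) N (max 0 (1 + s / N)) -
        (expMoment (k + 2) s * expMoment k s - expMoment (k + 1) s ^ 2) / expMoment k s ^ 2‖ ≤ D := by
    intro N
    refine isCompact_Icc.exists_bound_of_continuousOn (Continuous.continuousOn ?_)
    refine (continuous_const.mul (continuous_su11MeanDeriv_comp (k + 1) N (by fun_prop)
      fun s => le_max_left _ _)).sub (Continuous.div ?_ ?_ fun s => ?_)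
    · exact ((hcont _).mul (hcont _)).sub ((hcont _).pow 2)
    · exact (hcont _).pow 2
    · have h1 := le_expMoment k (abs_nonneg s) le_rfl
      have : 0 < Real.exp (-|s|) / (k + 1) := by positivity
      exact pow_ne_zero _ (by linarith)
  choose D hD using hbdd
  have hDN : ∀ N, 0 ≤ |D N| * N := fun N => by positivity
  have hS : 0 ≤ ∑ N ∈ Finset.range N₀, |D N| * N := Finset.sum_nonneg fun N _ => hDN N
  -- A bound `D N` is at most `(|D N| * N) / N`, so the sum covers every small `N`; the final 1
  -- makes the constant positive.
  refine ⟨C + ∑ N ∈ Finset.range N₀, |D N| * N + 1, by linarith, fun N hN s hs h0 => ?_⟩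
  have hN0 : (0 : ℝ) < N := by exact_mod_cast hN
  by_cases hNN : N₀ ≤ N
  · exact (h N hNN s hs).trans (div_le_div_of_nonneg_right (by linarith) hN0.le)
  · have h1 := hD N s (abs_le.1 hs)
    rw [max_eq_right h0, Real.norm_eq_abs] at h1
    refine h1.trans ?_
    rw [le_div_iff₀ hN0]
    have h2 := Finset.single_le_sum (f := fun N : ℕ => |D N| * (N : ℝ)) (fun N _ => hDN N)
      (Finset.mem_range.2 (not_le.1 hNN))
    have h3 : D N * N ≤ |D N| * N := mul_le_mul_of_nonneg_right (le_abs_self _) hN0.le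
    linarith

/-! ### Assembly of the three statements. -/

theorem su11Density_sqrt_mul_exp (L N : ℕ) {t : ℝ} (ht : 0 ≤ t) (θ : ℝ) :
    su11Density L N ((√t : ℝ) * Complex.exp (θ * Complex.I)) = Real.pi⁻¹ * su11MeanDeriv L N t := by
  rw [su11Density, norm_mul, Complex.norm_exp_ofReal_mul_I, mul_one, Complex.norm_real,
    Real.norm_of_nonneg (Real.sqrt_nonneg t), Real.sq_sqrt ht]

theorem mainTheorem1 (L : ℕ) (hL : 1 ≤ L) :
    -- the density of zeros exists and is unique
    (∀ (N : ℕ) (_ : 1 ≤ N) (Ω : Type u) [MeasurableSpace Ω] (P : Measure Ω)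
        [IsProbabilityMeasure P] (a : Fin (N + 1) → Ω → ℂ), IsIIDStdComplexGaussian P a →
      ∃! p : ℂ → ℝ, IsZeroDensity P (fun ω => su11Poly L (fun m => a m ω)) p) ∧
    -- its scaling limit at the unit circle, with rate
    (∀ A : ℝ, 0 < A → ∃ C : ℝ, 0 < C ∧
      ∀ (N : ℕ) (_ : 1 ≤ N) (Ω : Type u) [MeasurableSpace Ω] (P : Measure Ω)
        [IsProbabilityMeasure P] (a : Fin (N + 1) → Ω → ℂ), IsIIDStdComplexGaussian P a →
      ∀ p : ℂ → ℝ, IsZeroDensity P (fun ω => su11Poly L (fun m => a m ω)) p →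
      ∀ s : ℝ, -A ≤ s → s ≤ A → 0 ≤ 1 + s / N → ∀ θ : ℝ,
        |((N : ℝ) ^ 2)⁻¹ * p ((√(1 + s / N) : ℝ) * Complex.exp (θ * Complex.I))
            - 1 / Real.pi *
              deriv (fun t => iteratedDeriv L expQuot t / iteratedDeriv (L - 1) expQuot t) s|
          ≤ C / N) ∧
    -- the zeros concentrate in an annulus of width of order `1 / N` around the unit circle
    (∀ ε : ℝ, 0 < ε → ∃ A : ℝ, 0 < A ∧
      ∀ (N : ℕ) (_ : 1 ≤ N) (Ω : Type u) [MeasurableSpace Ω] (P : Measure Ω)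
        [IsProbabilityMeasure P] (a : Fin (N + 1) → Ω → ℂ), IsIIDStdComplexGaussian P a →
      Integrable (fun ω => (zeroCount (su11Poly L (fun m => a m ω))
          {z : ℂ | |‖z‖ - 1| ≤ A / N} : ℝ)) P ∧
      (1 - ε) * N ≤ ∫ ω, (zeroCount (su11Poly L (fun m => a m ω))
          {z : ℂ | |‖z‖ - 1| ≤ A / N} : ℝ) ∂P) := by

  refine ⟨?_, ?_, ?_⟩
  · intro N _ Ω _ P _ a ha
    exact ⟨su11Density L N, isZeroDensity_su11Density L ha,
      fun q hq => hq.unique (isZeroDensity_su11Density L ha)⟩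
  · intro A hA
    obtain ⟨k, rfl⟩ := Nat.exists_eq_add_of_le' hL
    obtain ⟨C, hC, h⟩ := exists_su11MeanDeriv_sub_le k hA
    refine ⟨C, hC, fun N hN Ω _ P _ a ha p hp s hs1 hs2 hs θ => ?_⟩
    rw [hp.unique (isZeroDensity_su11Density (k + 1) ha), su11Density_sqrt_mul_exp _ _ hs,
      Nat.add_sub_cancel, deriv_iteratedDeriv_expQuot_div, one_div, mul_left_comm, ← mul_sub,
      abs_mul, abs_of_pos (inv_pos.2 Real.pi_pos)]
    -- The common factor `π⁻¹` is at most 1 and is discarded.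
    refine (mul_le_of_le_one_left (abs_nonneg _) ?_).trans (h N hN s (abs_le.2 ⟨hs1, hs2⟩) hs)
    exact inv_le_one_of_one_le₀ (by linarith [Real.pi_gt_three])
  · intro ε hε
    obtain ⟨A, hA, h⟩ := exists_annulus_su11Poly hL hε
    refine ⟨A, hA, fun N hN Ω _ P _ a ha => ?_⟩
    have h1 := ha.integrable_comp (h N hN).1
    exact ⟨h1.1, (h N hN).2.trans_eq h1.2.symm⟩
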